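/- Consider the separable problem $$\text{(cP)}\qquad \min\ \sum_{i=1}^n f_i(x_i)\quad\text{s.t.}\quad \sum_{i=1}^n g_i(x_i)\le b,\quad x_i\in Y_i\ (i=1,\dots,n),$$ where $f_i:\mathbb{R}^{d_i}\to\mathbb{R}\cup\{+\infty\}$ is lower semicontinuous, $g_i:\mathbb{R}^{d_i}\to\mathbb{R}^m$ has lower semicontinuous coordinates $g_i^k$, $Y_i\subset\operatorname{dom} f_i$ is compact, and $b\in\mathbb{R}^m$. Inequalities between vectors are coordinatewise and $\mathbf 1_{Y}$ is $0$ on $Y$ and $+\infty$ outside $Y$. *Notation.* $\varphi^*(y)=\sup_x\{\langle y,x\rangle-\varphi(x)\}$ and $\varphi^{**}=(\varphi^*)^*$. For $\varphi$ on $\mathbb{R}^d$ let $\rho(\varphi)=\sup_{x\in\operatorname{dom}\varphi}\{\varphi(x)-\varphi^{**}(x)\}$, and for $k\ge 1$ let $\rho_k(\varphi)$ be the supremum of $\varphi\big(\sum_{j=1}^{d+1}\alpha_jx_j\big)-\sum_{j=1}^{d+1}\alpha_j\varphi(x_j)$ over $x_j\in\operatorname{dom}\varphi$, $\alpha\ge0$,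 $\sum_j\alpha_j=1$, with at most $k$ of the $\alpha_j$ nonzero. Put $\tilde f_i=f_i+\mathbf 1_{Y_i}$ and $\bar\rho_g=\sup_{i,k}\rho(g_i^k+\mathbf 1_{Y_i})$ (equal to $0$ if $n=0$ or $m=0$). For $u\in\mathbb{R}^m$ let $$h_{cP}(u)=\inf\Big\{\sum_i f_i(x_i):\ x_i\in Y_i,\ \sum_i g_i(x_i)-b\le u\Big\},\qquad h_{cD}=h_{cP}^{**}.$$ Let $\Psi(\lambda)=\inf_{x_i\in Y_i}\{\sum_i f_i(x_i)+\lambda^\top(\sum_i g_i(x_i)-b)\}$ be the Lagrange dual function; the dual problem (cD) is $\sup_{\lambda\ge0}\Psi(\lambda)$. Let $\mathcal G^{**}\subset\mathbb{R}^{1+m}$ be the closed convex hull of $$\mathcal G=\Big\{(r_0,r):\ \exists x_i\in Y_i,\ \sum_if_i(x_i)\le r_0,\ \sum_ig_i(x_i)-b\le r\Big\}.$$ We say that $z=(r_0,r)$ *attains the minimum in* (cD) if $z\in\mathcal G^{**}$, $r\le0$, $r_0=\sup_{\lambda\ge0}\Psi(\lambda)$ and, for every dual optimal $\lambda\ge0$,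 $z$ minimizes $r_0+\lambda^\top r$ over $\mathcal G^{**}$, with minimum value $\Psi(\lambda)$. Let $\mathcal F_i=\{(f_i(x),g_i(x)):x\in Y_i\}\subset\mathbb{R}^{1+m}$ and $$M_V=\sup\Big\{\Big\|\sum_iu_iv_i\Big\|_2:\ \|u\|_2\le1,\ v_i\in\mathcal F_i\Big\}\in[0,\infty].$$ A *representation* consists of points $x_{ij}\in Y_i$ and weights $\lambda_{ij}\ge0$ ($1\le i\le n$, $1\le j\le m+2$) with $\sum_j\lambda_{ij}=1$ for every $i$; write $z_{ij}=(f_i(x_{ij}),g_i(x_{ij}))$. Put $R_v=\max_{\{ij:\lambda_{ij}\ne1\}}\|\lambda_{ij}z_{ij}\|_2$ and $R_\lambda=\max_{\{ij:\lambda_{ij}\neq1\}}|\lambda_{ij}|$ (both $0$ if there are no such $ij$). **Statement.** There is an absolute constant $c>0$ such that the following holds for all such data with: every $\tilde f_i+\mathbf 1^\top g_i$ is proper, 1-coercive (it eventually exceeds $C\|x\|$, for every $C$, as $\|x\|\to\infty$), lower semicontinuous and minorized by an affine function; $\bar\rho_g<\infty$; and $h_{cD}(0)<+\infty$ (which holds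 if (cP) is feasible). 1. $h_{cD}(0)=\sup_{\lambda\ge0}\Psi(\lambda)$. 2. There exist a representation $(x^\star_{ij},\lambda_{ij})$ with at most $n+m+1$ nonzero weights in total and $w\in\mathbb{R}^m_+$ such that $$z^\star=\sum_{i=1}^n\sum_{j=1}^{m+2}\lambda_{ij}\,(f_i(x^\star_{ij}),g_i(x^\star_{ij}))+(0,-b+w)$$ attains the minimum in (cD). 3. For every such representation and $w$, and every $\gamma>0$, put $s=n+1+2m\frac{c}{\gamma^2+c}$. There is a representation $(y_{ij},\mu_{ij})$ with at most $s$ nonzero weights in total such that the error $$u(s)=(u_1(s),u_2(s))=\sum_{i,j}\mu_{ij}\,(f_i(y_{ij}),g_i(y_{ij}))+(0,-b+w)-z^\star\in\mathbb{R}\times\mathbb{R}^m$$ satisfies $$h_{cD}\big(u_2(s)+(m+1)\bar\rho_g\mathbf 1\big)\le h_{cP}\big(u_2(s)+(m+1)\bar\rho_g\mathbf 1\big)\le h_{cD}(0)+\mathrm{gap}(s),$$ $$\mathrm{gap}(s)=|u_1(s)|+\max_{\beta_i\in\{1,\dots,m+2\}}\Big\{\sum_{i=1}^n\rho_{\beta_i}(\tilde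 f_i):\ \sum_{i=1}^n\beta_i\le s\Big\},$$ and $$\max\{|u_1(s)|,\|u_2(s)\|_2\}\le\sqrt{2m}\,(R_v+R_\lambda M_V)\,\gamma .$$ (In the last bound $0\cdot\infty=0$; $\mathrm{gap}(s)$ may be $+\infty$.) -/

import Mathlib

/-- `ℝᵏ` with its Euclidean norm. -/
abbrev Vec (k : ℕ) : Type := EuclideanSpace ℝ (Fin k)

/-- `ℝ^(1+m)` with its Euclidean norm, written as pairs `(r₀, r)`, `r₀ ∈ ℝ`, `r ∈ ℝᵐ`. -/
abbrev ValSpace (m : ℕ) : Type := WithLp 2 (ℝ × Vec m)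

/-- The effective domain of an extended-real-valued function. -/
def effDom {d : ℕ} (φ : Vec d → EReal) : Set (Vec d) := {x | φ x < ⊤}

/-- The Fenchel conjugate `φ*(y) = sup_x (⟨y, x⟩ - φ(x))`. -/
noncomputable def fenchelConj {d : ℕ} (φ : Vec d → EReal) (y : Vec d) : EReal :=
  ⨆ x : Vec d, ((inner ℝ y x : ℝ) : EReal) - φ x

/-- The biconjugate `φ**` (the supremum of all affine minorants of `φ`). -/
noncomputable def biconj {d : ℕ} (φ : Vec d → EReal) : Vec d → EReal :=
  fenchelConj (fenchelConj φ)

open Classical in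
/-- The function `φ + 𝟏_Y`, equal to `φ` on `Y` and to `+∞` outside of `Y`. -/
noncomputable def extendTop {d : ℕ} (φ : Vec d → EReal) (Y : Set (Vec d)) (x : Vec d) : EReal :=
  if x ∈ Y then φ x else ⊤

/-- The lack of convexity `ρ(φ) = sup_{x ∈ dom φ} (φ(x) - φ**(x))`. -/
noncomputable def rho {d : ℕ} (φ : Vec d → EReal) : EReal :=
  ⨆ x ∈ effDom φ, φ x - biconj φ x

/-- The `k`-th nonconvexity measure: the supremum of `φ(∑ αⱼ xⱼ) - ∑ αⱼ φ(xⱼ)` over `d + 1` points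
of `dom φ` and convex weights with at most `k` nonzero entries. -/
noncomputable def rhoK {d : ℕ} (k : ℕ) (φ : Vec d → EReal) : EReal :=
  ⨆ (x : Fin (d + 1) → Vec d) (α : Fin (d + 1) → ℝ)
    (_ : (∀ j, x j ∈ effDom φ) ∧ (∀ j, 0 ≤ α j) ∧ ∑ j, α j = 1 ∧ {j | α j ≠ 0}.ncard ≤ k),
    φ (∑ j, α j • x j) - ((∑ j, α j * (φ (x j)).toReal : ℝ) : EReal)

/-- Proper, 1-coercive, lower semicontinuous, and minorized by an affine function. -/
structure IsTame {d : ℕ} (φ : Vec d → EReal) : Prop where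
  dom_nonempty : (effDom φ).Nonempty
  ne_bot : ∀ x, φ x ≠ ⊥
  coercive : ∀ C : ℝ, ∀ᶠ x in Bornology.cobounded (Vec d), ((C * ‖x‖ : ℝ) : EReal) ≤ φ x
  lsc : LowerSemicontinuous φ
  affine_minorant : ∃ (a : Vec d) (c : ℝ), ∀ x, ((inner ℝ a x + c : ℝ) : EReal) ≤ φ x

/-- Data of the problem: minimize `∑ᵢ fᵢ(xᵢ)` subject to `∑ᵢ gᵢ(xᵢ) ≤ b` and `xᵢ ∈ Yᵢ`. -/
structure SepProblem (n m : ℕ) (d : Fin n → ℕ) where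
  f : ∀ i, Vec (d i) → EReal
  g : ∀ i, Vec (d i) → Vec m
  Y : ∀ i, Set (Vec (d i))
  b : Vec m

namespace SepProblem

/-- The objective term `fᵢ + 𝟏_{Yᵢ}`. -/
noncomputable def fY {n m : ℕ} {d : Fin n → ℕ} (P : SepProblem n m d) (i : Fin n) :
    Vec (d i) → EReal :=
  extendTop (P.f i) (P.Y i)

/-- The `k`-th coordinate of `gᵢ`, extended by `+∞` outside of `Yᵢ`. -/
noncomputable def gY {n m : ℕ} {d : Fin n → ℕ} (P : SepProblem n m d) (i : Fin n) (k : Fin m) :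
    Vec (d i) → EReal :=
  extendTop (fun x => ((P.g i x k : ℝ) : EReal)) (P.Y i)

/-- The value function `h_cP(u)` of the primal problem with constraints `∑ᵢ gᵢ(xᵢ) - b ≤ u`. -/
noncomputable def hcP {n m : ℕ} {d : Fin n → ℕ} (P : SepProblem n m d) (u : Vec m) : EReal :=
  ⨅ (x : ∀ i, Vec (d i))
    (_ : (∀ i, x i ∈ P.Y i) ∧ ∀ k, ∑ i, P.g i (x i) k - P.b k ≤ u k), ∑ i, P.f i (x i)

/-- `h_cD = h_cP**`. -/
noncomputable def hcD {n m : ℕ} {d : Fin n → ℕ} (P : SepProblem n m d) : Vec m → EReal :=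
  biconj P.hcP

/-- The Lagrange dual function. -/
noncomputable def Psi {n m : ℕ} {d : Fin n → ℕ} (P : SepProblem n m d) (lam : Vec m) : EReal :=
  ⨅ (x : ∀ i, Vec (d i)) (_ : ∀ i, x i ∈ P.Y i),
    ∑ i, P.f i (x i) + ((∑ k, lam k * (∑ i, P.g i (x i) k - P.b k) : ℝ) : EReal)

/-- The optimal value of the Lagrange dual problem `sup_{lam ≥ 0} Ψ(lam)`. -/
noncomputable def dualValue {n m : ℕ} {d : Fin n → ℕ} (P : SepProblem n m d) : EReal :=
  ⨆ (lam : Vec m) (_ : ∀ k, 0 ≤ lam k), P.Psi lam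

/-- The epigraph of the problem, projected on the objective and constraint values. -/
def epiSet {n m : ℕ} {d : Fin n → ℕ} (P : SepProblem n m d) : Set (ValSpace m) :=
  {z | ∃ x : ∀ i, Vec (d i), (∀ i, x i ∈ P.Y i) ∧
    ∑ i, P.f i (x i) ≤ ((z.fst : ℝ) : EReal) ∧ ∀ k, ∑ i, P.g i (x i) k - P.b k ≤ z.snd k}

/-- The closed convex hull of the projected epigraph. -/
def epiHull {n m : ℕ} {d : Fin n → ℕ} (P : SepProblem n m d) : Set (ValSpace m) :=
  closure (convexHull ℝ P.epiSet)

/-- `z = (r₀, r)` attains the minimum in the dual problem: it lies in the closed convex hull of the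
epigraph, `r ≤ 0`, `r₀` is the dual value, and for every dual optimal multiplier `lam` it
minimizes `r₀ + ⟨lam, r⟩` over that hull, with minimum value `Ψ(lam)`. -/
structure AttainsDual {n m : ℕ} {d : Fin n → ℕ} (P : SepProblem n m d) (z : ValSpace m) :
    Prop where
  mem_hull : z ∈ P.epiHull
  nonpos : ∀ k, z.snd k ≤ 0
  value : ((z.fst : ℝ) : EReal) = P.dualValue
  lagrangian : ∀ lam : Vec m, (∀ k, 0 ≤ lam k) → P.Psi lam = P.dualValue →
    IsMinOn (fun y : ValSpace m => y.fst + ∑ k, lam k * y.snd k) P.epiHull z ∧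
      ((z.fst + ∑ k, lam k * z.snd k : ℝ) : EReal) = P.Psi lam

/-- The point `(fᵢ(x), gᵢ(x))` of `ℝ^(1+m)`. -/
noncomputable def val {n m : ℕ} {d : Fin n → ℕ} (P : SepProblem n m d) (i : Fin n)
    (x : Vec (d i)) : ValSpace m :=
  WithLp.toLp 2 ((P.f i x).toReal, P.g i x)

/-- The points `x i j` lie in `Yᵢ` and each row of `lam` is a vector of convex weights. -/
def IsRep {n m : ℕ} {d : Fin n → ℕ} (P : SepProblem n m d)
    (x : ∀ i, Fin (m + 2) → Vec (d i)) (lam : Fin n → Fin (m + 2) → ℝ) : Prop :=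
  (∀ i j, x i j ∈ P.Y i) ∧ (∀ i j, 0 ≤ lam i j) ∧ ∀ i, ∑ j, lam i j = 1

/-- The point `∑ᵢ ∑ⱼ lamᵢⱼ (fᵢ(xᵢⱼ), gᵢ(xᵢⱼ)) + (0, -b + w)`. -/
noncomputable def repPoint {n m : ℕ} {d : Fin n → ℕ} (P : SepProblem n m d)
    (x : ∀ i, Fin (m + 2) → Vec (d i)) (lam : Fin n → Fin (m + 2) → ℝ) (w : Vec m) : ValSpace m :=
  ∑ i, ∑ j, lam i j • P.val i (x i j) + WithLp.toLp 2 (0, -P.b + w)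

/-- `R_v`, the maximum of `‖lamᵢⱼ (fᵢ(xᵢⱼ), gᵢ(xᵢⱼ))‖₂` over the `i, j` with `lamᵢⱼ ≠ 1`. -/
noncomputable def Rv {n m : ℕ} {d : Fin n → ℕ} (P : SepProblem n m d)
    (x : ∀ i, Fin (m + 2) → Vec (d i)) (lam : Fin n → Fin (m + 2) → ℝ) : ENNReal :=
  ⨆ (i : Fin n) (j : Fin (m + 2)) (_ : lam i j ≠ 1), ‖lam i j • P.val i (x i j)‖ₑ

/-- `M_V`, the supremum of `‖∑ᵢ uᵢ vᵢ‖₂` over `‖u‖₂ ≤ 1` and `vᵢ ∈ {(fᵢ(x), gᵢ(x)) : x ∈ Yᵢ}`. -/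
noncomputable def MV {n m : ℕ} {d : Fin n → ℕ} (P : SepProblem n m d) : ENNReal :=
  ⨆ (u : Vec n) (x : ∀ i, Vec (d i)) (_ : ‖u‖ ≤ 1 ∧ ∀ i, x i ∈ P.Y i),
    ‖∑ i, u i • P.val i (x i)‖ₑ

/-- `ρ̄_g`, the supremum of the lacks of convexity of the coordinates of the `gᵢ`. -/
noncomputable def rhoBarG {n m : ℕ} {d : Fin n → ℕ} (P : SepProblem n m d) : EReal :=
  ⨆ (i : Fin n) (k : Fin m), rho (P.gY i k)

/-- The maximum of `∑ᵢ ρ_{βᵢ}(fᵢ)` over integers `βᵢ ∈ [1, m + 2]` with `∑ᵢ βᵢ ≤ s`. -/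
noncomputable def maxRho {n m : ℕ} {d : Fin n → ℕ} (P : SepProblem n m d) (s : ℝ) : EReal :=
  ⨆ (β : Fin n → ℕ) (_ : (∀ i, 1 ≤ β i ∧ β i ≤ m + 2) ∧ ((∑ i, β i : ℕ) : ℝ) ≤ s),
    ∑ i, rhoK (β i) (P.fY i)

/-- The perturbation `u + (m + 1) ρ̄_g 𝟏`. -/
noncomputable def shift {n m : ℕ} {d : Fin n → ℕ} (P : SepProblem n m d) (u : Vec m) : Vec m :=
  WithLp.toLp 2 fun k => u k + (m + 1) * P.rhoBarG.toReal

end SepProblem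

/-- `R_lam`, the maximum of `|lamᵢⱼ|` over the `i, j` with `lamᵢⱼ ≠ 1`. -/
noncomputable def weightRadius {n p : ℕ} (lam : Fin n → Fin p → ℝ) : ENNReal :=
  ⨆ (i : Fin n) (j : Fin p) (_ : lam i j ≠ 1), ‖lam i j‖ₑ

/-- The total number of nonzero weights. -/
noncomputable def totalCard {n p : ℕ} (lam : Fin n → Fin p → ℝ) : ℕ :=
  ∑ i, {j | lam i j ≠ 0}.ncard

/-- `s = n + 1 + 2 m c / (γ² + c)`. -/
noncomputable def sparsity (n m : ℕ) (c γ : ℝ) : ℝ := n + 1 + 2 * m * (c / (γ ^ 2 + c))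

/-! ### Basic solutions, the Shapley-Folkman lemma and sampling -/

section Weights

open Finset Module

/-! Duality. `hcP` is nonincreasing, so its conjugate is `⊤` outside the negative orthant, and at
`-lam` with `lam ≥ 0` it is `-Psi lam`; hence `hcD 0` is the dual value. A point `(dual value, 0)`
outside the closed convex hull of the epigraph could be separated from it, and the separating
functional would be a multiplier better than optimal. So that point lies in the hull
(`mem_epiHull`). Compactness and lower semicontinuity put a sum of rowwise convex combinations below
it (`exists_repPoint_le`); Shapley-Folkman in dimension `m + 1` leaves `n + m + 1` nonzero weights,
and weak duality forces equality in the objective.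

Sparsification. With so few nonzero weights, at most `2m + 2` of them lie strictly between `0` and
`1`. Maurey's sampling argument replaces these by the frequencies of `k` draws (`exists_sampling`).
The row sums then differ from `1`; they are tracked in `n` extra coordinates scaled by `M_V`, so one
Hilbert-space estimate controls both the sampling error and the error of renormalising the rows
(`exists_sparse_weights`). The value `c = 16` is tuned so that sampling is needed only when `γ² ≥
16`, and there it is accurate enough.

Primal recovery. Each row is replaced by its barycentre. This costs `rhoK` of the number of its
nonzero weights in the objective, and `rhoBarG` in the constraints for rows with at least two
nonzero weights, of which there are at most `m + 1` (`hcP_shift_le`). -/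

theorem ncard_ne_zero_eq {ι : Type*} [Fintype ι] (w : ι → ℝ) :
    {i | w i ≠ 0}.ncard = #{i | w i ≠ 0} := by
  classical
  rw [Set.ncard_eq_toFinset_card']
  simp

/-- A step of the simplex method: nonnegative weights on too many points can be moved, without
increasing a linear cost, until one of them vanishes. -/
theorem exists_weights_card_lt {ι E : Type*} [Fintype ι] [AddCommGroup E] [Module ℝ E]
    [FiniteDimensional ℝ E] (a : ι → E) (l : E →ₗ[ℝ] ℝ) (hl : ∀ i, l (a i) = 1) (c μ : ι → ℝ)
    (hμ : ∀ i, 0 ≤ μ i) (hcard : finrank ℝ E < #{i | μ i ≠ 0}) :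
    ∃ α : ι → ℝ, (∀ i, 0 ≤ α i) ∧ ∑ i, α i • a i = ∑ i, μ i • a i ∧
      ∑ i, α i * c i ≤ ∑ i, μ i * c i ∧ (∀ i, μ i = 0 → α i = 0) ∧
      #{i | α i ≠ 0} < #{i | μ i ≠ 0} := by
  classical
  obtain ⟨g, hg0, hgsupp, hgne, hgc⟩ : ∃ g : ι → ℝ, ∑ i, g i • a i = 0 ∧
      (∀ i, μ i = 0 → g i = 0) ∧ (∃ i, g i ≠ 0) ∧ ∑ i, g i * c i ≤ 0 := by
    have hdep : ¬ LinearIndependent ℝ (fun i : {i // i ∈ ({i | μ i ≠ 0} : Finset ι)} => a i) := by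
      intro h
      have := h.fintype_card_le_finrank
      rw [Fintype.card_coe] at this
      omega
    obtain ⟨g, hg, ⟨i₀, hi₀⟩⟩ := Fintype.not_linearIndependent_iff.1 hdep
    let g' : ι → ℝ := fun i => if h : i ∈ ({i | μ i ≠ 0} : Finset ι) then g ⟨i, h⟩ else 0
    have hg' : ∑ i, g' i • a i = 0 := by
      rw [← hg]
      symm
      refine Fintype.sum_of_injective (fun i : {i // i ∈ ({i | μ i ≠ 0} : Finset ι)} => i.1)
        Subtype.val_injective _ _ ?_ ?_
      · intro i hi
        have : i ∉ ({i | μ i ≠ 0} : Finset ι) := fun h => hi ⟨⟨i, h⟩, rfl⟩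
        simp only [g', dif_neg this, zero_smul]
      · intro i
        simp only [g', dif_pos i.2]
    have hs : ∀ i, μ i = 0 → g' i = 0 := by
      intro i hi
      have : i ∉ ({i | μ i ≠ 0} : Finset ι) := by simp [hi]
      simp only [g', dif_neg this]
    have hne : g' i₀.1 ≠ 0 := by
      simp only [g', dif_pos i₀.2]
      exact hi₀
    rcases le_total (∑ i, g' i * c i) 0 with h | h
    · exact ⟨g', hg', hs, ⟨_, hne⟩, h⟩
    · refine ⟨fun i => - g' i, ?_, fun i hi => by simp [hs i hi], ⟨_, neg_ne_zero.2 hne⟩, ?_⟩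
      · simp [neg_smul, hg']
      · simp only [neg_mul, sum_neg_distrib]
        linarith
  -- Applying `l` shows that the entries of the dependence sum to zero. Being nonzero, it has a
  -- negative entry, so the ratio test gives a finite largest step that keeps the weights
  -- nonnegative.
  have hgsum : ∑ i, g i = 0 := by
    have := congrArg l hg0
    simpa [map_sum, hl] using this
  have hneg : ({i | g i < 0} : Finset ι).Nonempty := by
    by_contra h
    rw [not_nonempty_iff_eq_empty, filter_eq_empty_iff] at h
    have h0 : ∀ i ∈ univ, 0 ≤ g i := fun i hi => not_lt.1 (h hi)
    obtain ⟨i, hi⟩ := hgne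
    exact hi ((sum_eq_zero_iff_of_nonneg h0).1 hgsum i (mem_univ i))
  obtain ⟨i₀, hi₀, hmin⟩ := exists_min_image _ (fun i => μ i / (-g i)) hneg
  simp only [mem_filter, mem_univ, true_and] at hi₀ hmin
  set t := μ i₀ / (-g i₀) with ht
  have ht0 : 0 ≤ t := div_nonneg (hμ _) (by linarith)
  have hti : μ i₀ + t * g i₀ = 0 := by
    have := hi₀.ne
    rw [ht]
    field_simp
    simp
  refine ⟨fun i => μ i + t * g i, ?_, ?_, ?_, ?_, ?_⟩
  · intro i
    rcases lt_or_ge (g i) 0 with h | h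
    · have := hmin i h
      rw [le_div_iff₀ (by linarith)] at this
      linarith
    · have := hμ i
      positivity
  · simp only [add_smul, sum_add_distrib, mul_smul, ← smul_sum, hg0, smul_zero, add_zero]
  · simp only [add_mul, sum_add_distrib, mul_assoc, ← mul_sum]
    nlinarith
  · intro i hi
    simp [hi, hgsupp i hi]
  · refine card_lt_card ⟨?_, ?_⟩
    · intro i
      simp only [mem_filter, mem_univ, true_and]
      exact fun h h' => h (by simp [h', hgsupp i h'])
    · intro h
      have hmem : i₀ ∈ ({i | μ i ≠ 0} : Finset ι) := by
        simp only [mem_filter, mem_univ, true_and]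
        exact fun h' => hi₀.ne (hgsupp _ h')
      have := h hmem
      simp only [mem_filter, mem_univ, true_and] at this
      exact this hti

/-- Existence of basic solutions: nonnegative weights can be replaced, without increasing a linear
cost, by weights on at most `finrank ℝ E` points. -/
theorem exists_weights_card_le {ι E : Type*} [Fintype ι] [AddCommGroup E] [Module ℝ E]
    [FiniteDimensional ℝ E] (a : ι → E) (l : E →ₗ[ℝ] ℝ) (hl : ∀ i, l (a i) = 1) (c μ : ι → ℝ)
    (hμ : ∀ i, 0 ≤ μ i) :
    ∃ α : ι → ℝ, (∀ i, 0 ≤ α i) ∧ ∑ i, α i • a i = ∑ i, μ i • a i ∧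
      ∑ i, α i * c i ≤ ∑ i, μ i * c i ∧ (∀ i, μ i = 0 → α i = 0) ∧
      #{i | α i ≠ 0} ≤ finrank ℝ E := by
  induction hk : #{i | μ i ≠ 0} using Nat.strong_induction_on generalizing μ with
  | _ k ih =>
    subst hk
    rcases le_or_gt #{i | μ i ≠ 0} (finrank ℝ E) with h | h
    · exact ⟨μ, hμ, rfl, le_rfl, fun _ => id, h⟩
    · obtain ⟨α, h1, h2, h3, h4, h5⟩ := exists_weights_card_lt a l hl c μ hμ h
      obtain ⟨β, g1, g2, g3, g4, g5⟩ := ih _ h5 α h1 rfl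
      exact ⟨β, g1, g2.trans h2, g3.trans h3, fun i hi => g4 i (h4 i hi), g5⟩

/-- The Shapley-Folkman lemma: a sum of `n` convex combinations in a space of dimension `D` can be
written with at most `n + D` nonzero weights. -/
theorem shapleyFolkman {n : ℕ} {T E : Type*} [Fintype T] [AddCommGroup E] [Module ℝ E]
    [FiniteDimensional ℝ E] (p : Fin n → T → E) (μ : Fin n → T → ℝ) (hμ : ∀ i t, 0 ≤ μ i t)
    (hsum : ∀ i, ∑ t, μ i t = 1) :
    ∃ α : Fin n → T → ℝ, (∀ i t, 0 ≤ α i t) ∧ (∀ i, ∑ t, α i t = 1) ∧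
      ∑ i, ∑ t, α i t • p i t = ∑ i, ∑ t, μ i t • p i t ∧
      ∑ i, #{t | α i t ≠ 0} ≤ n + finrank ℝ E := by
  classical
  -- The extra basis vector records the row, so preserving the weighted sum also preserves every row
  -- sum, and a basic solution has at most `finrank ℝ E + n` nonzero entries.
  let a : Fin n × T → E × (Fin n → ℝ) := fun q => (p q.1 q.2, Pi.single q.1 1)
  let l : E × (Fin n → ℝ) →ₗ[ℝ] ℝ := (∑ i, LinearMap.proj i) ∘ₗ LinearMap.snd ℝ _ _
  have hl : ∀ q, l (a q) = 1 := by
    intro q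
    simp [l, a]
  obtain ⟨α, h0, h1, -, -, h2⟩ :=
    exists_weights_card_le a l hl 0 (fun q => μ q.1 q.2) (fun q => hμ _ _)
  have e1 := congrArg Prod.fst h1
  have e2 := congrArg Prod.snd h1
  simp only [Prod.fst_sum, Prod.snd_sum, Prod.smul_fst, Prod.smul_snd, a,
    Fintype.sum_prod_type] at e1 e2
  refine ⟨fun i t => α (i, t), fun _ _ => h0 _, fun i => ?_, e1, ?_⟩
  · have := congrFun e2 i
    simp only [Finset.sum_apply, Pi.smul_apply, Pi.single_apply, smul_eq_mul, mul_ite, mul_one,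
      mul_zero] at this
    rw [sum_eq_single i (by intro j _ hj; simp [hj.symm]) (by simp),
      sum_eq_single i (by intro j _ hj; simp [hj.symm]) (by simp)] at this
    simpa [hsum] using this
  · rw [finrank_prod, finrank_pi, Fintype.card_fin, add_comm] at h2
    refine le_trans (le_of_eq ?_) h2
    simp only [card_filter, Fintype.sum_prod_type]

/-- Convex weights with at most `N` nonzero entries can be indexed by `Fin N`. -/
theorem exists_reindex {T : Type*} [Fintype T] [Nonempty T] (α : T → ℝ) {N : ℕ}
    (hN : #{t | α t ≠ 0} ≤ N) :
    ∃ (τ : Fin N → T) (ν : Fin N → ℝ), ((∀ t, 0 ≤ α t) → ∀ j, 0 ≤ ν j) ∧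
      #{j | ν j ≠ 0} = #{t | α t ≠ 0} ∧
      ∀ {E : Type} [AddCommGroup E] [Module ℝ E] (p : T → E),
        ∑ j, ν j • p (τ j) = ∑ t, α t • p t := by
  classical
  let S : Finset T := {t | α t ≠ 0}
  obtain ⟨e⟩ : Nonempty (S ↪ Fin N) := by
    apply Function.Embedding.nonempty_of_card_le
    rwa [Fintype.card_coe, Fintype.card_fin]
  let τ : Fin N → T := fun j => if h : ∃ s, e s = j then (h.choose : T) else Classical.arbitrary T
  let ν : Fin N → ℝ := fun j => if ∃ s, e s = j then α (τ j) else 0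
  have hτ : ∀ s, τ (e s) = s := by
    intro s
    have h : ∃ s', e s' = e s := ⟨s, rfl⟩
    simp only [τ, dif_pos h]
    exact congrArg _ (e.injective h.choose_spec)
  have hν : ∀ s, ν (e s) = α s := by
    intro s
    have h : ∃ s', e s' = e s := ⟨s, rfl⟩
    simp only [ν, if_pos h, hτ]
  have hν' : ∀ j, j ∉ Set.range e → ν j = 0 := by
    intro j hj
    exact if_neg hj
  refine ⟨τ, ν, ?_, ?_, ?_⟩
  · intro h j
    simp only [ν]
    split_ifs
    · exact h _
    · exact le_rfl
  · have : ({j | ν j ≠ 0} : Finset (Fin N)) = S.attach.map e := by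
      ext j
      simp only [mem_filter, mem_univ, true_and, mem_map, mem_attach]
      constructor
      · intro h
        by_contra h'
        exact h (hν' j h')
      · rintro ⟨s, rfl⟩
        rw [hν]
        exact (mem_filter.1 s.2).2
    rw [this, card_map, card_attach]
  · intro E _ _ p
    trans ∑ s : S, α s • p s
    · symm
      refine Fintype.sum_of_injective e e.injective _ _ ?_ ?_
      · intro j hj
        simp [hν' j hj]
      · intro s
        rw [hν, hτ]
    · refine Fintype.sum_of_injective (fun s : S => s.1) Subtype.val_injective _ _ ?_ ?_
      · intro t ht
        have : α t = 0 := by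
          by_contra h
          exact ht ⟨⟨t, by simpa [S] using h⟩, rfl⟩
        simp [this]
      · intro s
        rfl

/-- Approximation by sampling: some `k` draws with repetition from a family of `N` vectors of norm
at most `r` have `N` times their sum within `√k * N * r` of `k` times the sum of the family. -/
theorem exists_sampling {ι H : Type*} [Fintype ι] [Nonempty ι] [NormedAddCommGroup H]
    [InnerProductSpace ℝ H] (a : ι → H) (R : ℝ) (hR : ∀ i, ‖a i‖ ^ 2 ≤ R) (k : ℕ) :
    ∃ q : ι → ℕ, ∑ i, q i = k ∧
      ‖∑ i, ((Fintype.card ι : ℝ) * q i - k) • a i‖ ^ 2 ≤ k * (Fintype.card ι : ℝ) ^ 2 * R := by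
  classical
  set N : ℝ := (Fintype.card ι : ℝ) with hN
  have hN0 : 0 < N := by
    rw [hN]
    exact_mod_cast Fintype.card_pos
  induction k with
  | zero => exact ⟨0, by simp, by simp⟩
  | succ k ih =>
    obtain ⟨q, hq, hb⟩ := ih
    set X := ∑ i, (N * q i - k) • a i with hX
    set s := ∑ i, a i with hs
    -- The increments `N • a e - s` have mean zero over `e`, so on average they add only their
    -- variance to `‖X‖ ^ 2`; some `e` does no worse than the average.
    obtain ⟨e, he⟩ : ∃ e, ‖X + (N • a e - s)‖ ^ 2 ≤ ‖X‖ ^ 2 + N ^ 2 * R := by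
      by_contra! hcon
      have h1 : ∑ _e : ι, (‖X‖ ^ 2 + N ^ 2 * R) < ∑ e, ‖X + (N • a e - s)‖ ^ 2 :=
        sum_lt_sum_of_nonempty univ_nonempty fun e _ => hcon e
      have h2 : ∀ e, ‖X + (N • a e - s)‖ ^ 2 = ‖X‖ ^ 2 + ‖s‖ ^ 2 - 2 * inner ℝ X s
          + 2 * N * inner ℝ (X - s) (a e) + N ^ 2 * ‖a e‖ ^ 2 := by
        intro e
        rw [norm_add_sq_real, norm_sub_sq_real, norm_smul, mul_pow, inner_sub_right,
          inner_sub_left, inner_smul_right, inner_smul_left, Real.norm_eq_abs, sq_abs,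
          real_inner_comm s (a e)]
        simp only [conj_trivial]
        ring
      have h3 : ∑ e, ‖X + (N • a e - s)‖ ^ 2 = N * (‖X‖ ^ 2 + ‖s‖ ^ 2 - 2 * inner ℝ X s)
          + 2 * N * inner ℝ (X - s) s + N ^ 2 * ∑ e, ‖a e‖ ^ 2 := by
        simp only [h2, sum_add_distrib, ← mul_sum, ← inner_sum, ← hs, sum_const, card_univ,
          nsmul_eq_mul, ← hN]
      have h4 : ∑ e, ‖a e‖ ^ 2 ≤ N * R := by
        calc ∑ e, ‖a e‖ ^ 2 ≤ ∑ _e : ι, R := sum_le_sum fun e _ => hR e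
          _ = N * R := by simp [hN]
      rw [h3, inner_sub_left, real_inner_self_eq_norm_sq] at h1
      simp only [sum_const, card_univ, nsmul_eq_mul, ← hN] at h1
      have h5 : N ^ 2 * ∑ e, ‖a e‖ ^ 2 ≤ N ^ 2 * (N * R) := by gcongr
      nlinarith [mul_nonneg hN0.le (sq_nonneg ‖s‖)]
    refine ⟨fun i => q i + if i = e then 1 else 0, ?_, ?_⟩
    · simp [sum_add_distrib, hq]
    · have : ∑ i, (N * ((q i + if i = e then 1 else 0 : ℕ) : ℝ) - ((k + 1 : ℕ) : ℝ)) • a i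
          = X + (N • a e - s) := by
        rw [hX, hs]
        have : N • a e = ∑ i, (N * if i = e then (1 : ℝ) else 0) • a i := by simp
        rw [this, ← sum_sub_distrib, ← sum_add_distrib]
        refine sum_congr rfl fun i _ => ?_
        push_cast
        module
      rw [this]
      push_cast
      nlinarith

end Weights

/-! ### Semicontinuity and closed upper images -/

section Semicontinuity

/-- The product of a nonnegative continuous function and a lower semicontinuous function which is
bounded below is lower semicontinuous. -/
theorem LowerSemicontinuous.continuous_mul {X : Type*} [TopologicalSpace X] {l h : X → ℝ}
    (hl : Continuous l) (hl0 : ∀ x, 0 ≤ l x) (hh : LowerSemicontinuous h) {B : ℝ}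
    (hB : ∀ x, B ≤ h x) : LowerSemicontinuous fun x => l x * h x := by
  intro x y hy
  change y < l x * h x at hy
  change ∀ᶠ z in nhds x, y < l z * h z
  rcases (hl0 x).eq_or_lt with h0 | h0
  -- Where `l` vanishes, `h` may be arbitrarily large nearby but not below `B`, so the product is at
  -- least `l * B`, which tends to zero.
  · have h1 : Filter.Tendsto (fun x => l x * B) (nhds x) (nhds (l x * B)) :=
      (hl.mul continuous_const).tendsto x
    rw [← h0, zero_mul] at h1 hy
    filter_upwards [h1.eventually (lt_mem_nhds hy)] with z hz
    exact hz.trans_le (mul_le_mul_of_nonneg_left (hB z) (hl0 z))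
  · have h1 : y / l x < h x := by
      rw [div_lt_iff₀ h0]
      linarith
    obtain ⟨t, ht1, ht2⟩ := exists_between h1
    have h2 : Filter.Tendsto (fun x => l x * t) (nhds x) (nhds (l x * t)) :=
      (hl.mul continuous_const).tendsto x
    rw [div_lt_iff₀ h0, mul_comm] at ht1
    filter_upwards [h2.eventually (lt_mem_nhds ht1), hh x t ht2] with z hz1 hz2
    exact hz1.trans_le (mul_le_mul_of_nonneg_left hz2.le (hl0 z))

/-- The points above the image of a compact space under a family of lower semicontinuous functions
form a closed set. -/
theorem isClosed_setOf_exists_le {X κ : Type*} [TopologicalSpace X] [CompactSpace X]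
    {Φ : κ → X → ℝ} (hΦ : ∀ k, LowerSemicontinuous (Φ k)) :
    IsClosed {z : κ → ℝ | ∃ x, ∀ k, Φ k x ≤ z k} := by
  have h : IsClosed {p : X × (κ → ℝ) | ∀ k, Φ k p.1 ≤ p.2 k} := by
    rw [Set.ofPred_forall]
    refine isClosed_iInter fun k => ?_
    exact IsClosed.preimage (f := fun p : X × (κ → ℝ) => (p.1, p.2 k)) (by fun_prop)
      (hΦ k).isClosed_epigraph
  have := isClosedMap_snd_of_compactSpace _ h
  convert this using 1
  ext z
  simp

end Semicontinuity

/-! ### Coordinates, extended-real sums and the biconjugate -/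

theorem WithLp.sum_fst {ι V W : Type*} [AddCommGroup V] [AddCommGroup W] (s : Finset ι)
    (z : ι → WithLp 2 (V × W)) : (∑ i ∈ s, z i).fst = ∑ i ∈ s, (z i).fst := by
  classical
  induction s using Finset.induction_on with
  | empty => simp
  | insert i s hi ih => simp [Finset.sum_insert hi, ih]

theorem WithLp.sum_snd {ι V W : Type*} [AddCommGroup V] [AddCommGroup W] (s : Finset ι)
    (z : ι → WithLp 2 (V × W)) : (∑ i ∈ s, z i).snd = ∑ i ∈ s, (z i).snd := by
  classical
  induction s using Finset.induction_on with
  | empty => simp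
  | insert i s hi ih => simp [Finset.sum_insert hi, ih]

theorem EReal.coe_fintype_sum {ι : Type*} [Fintype ι] (a : ι → ℝ) :
    ((∑ i, a i : ℝ) : EReal) = ∑ i, (a i : EReal) :=
  map_sum (⟨⟨Real.toEReal, EReal.coe_zero⟩, EReal.coe_add⟩ : ℝ →+ EReal) a Finset.univ

theorem biconj_le {d : ℕ} (φ : Vec d → EReal) (x : Vec d) : biconj φ x ≤ φ x := by
  refine iSup_le fun y => ?_
  have h : ((inner ℝ y x : ℝ) : EReal) - φ x ≤ fenchelConj φ y :=
    le_iSup (fun x => ((inner ℝ y x : ℝ) : EReal) - φ x) x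
  rw [real_inner_comm]
  rcases eq_or_ne (φ x) ⊥ with h0 | h0
  · rw [h0, EReal.coe_sub_bot, top_le_iff] at h
    simp [h]
  rcases eq_or_ne (φ x) ⊤ with h1 | h1
  · simp [h1]
  lift φ x to ℝ using ⟨h1, h0⟩ with r
  refine EReal.sub_le_of_le_add' ?_
  rw [← EReal.coe_sub] at h
  calc ((inner ℝ y x : ℝ) : EReal) = ((inner ℝ y x - r : ℝ) : EReal) + r := by
        rw [← EReal.coe_add, sub_add_cancel]
    _ ≤ _ := by gcongr

/-! ### Regular problems and Lagrange duality -/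

namespace SepProblem

variable {n m : ℕ} {d : Fin n → ℕ} {P : SepProblem n m d}

/-- The part of the standing assumptions used below: lower semicontinuous functions, which are
finite on nonempty compact sets. -/
structure IsRegular (P : SepProblem n m d) : Prop where
  lsc_f : ∀ i, LowerSemicontinuous (P.f i)
  lsc_g : ∀ i k, LowerSemicontinuous fun x => P.g i x k
  isCompact : ∀ i, IsCompact (P.Y i)
  nonempty : ∀ i, (P.Y i).Nonempty
  coe_f : ∀ i, ∀ x ∈ P.Y i, ((P.f i x).toReal : EReal) = P.f i x

/-- Properness does the work: a point of the effective domain must lie in `Yᵢ`, and `fᵢ` cannot be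
`⊥` on `Yᵢ`. -/
theorem isRegular_of_isTame (hf : ∀ i, LowerSemicontinuous (P.f i))
    (hg : ∀ i k, LowerSemicontinuous fun x => P.g i x k) (hY : ∀ i, IsCompact (P.Y i))
    (hdom : ∀ i, P.Y i ⊆ effDom (P.f i))
    (htame : ∀ i, IsTame fun x => P.fY i x + ((∑ k, P.g i x k : ℝ) : EReal)) : P.IsRegular where
  lsc_f := hf
  lsc_g := hg
  isCompact := hY
  nonempty i := by
    obtain ⟨x, hx⟩ := (htame i).dom_nonempty
    refine ⟨x, ?_⟩
    by_contra h
    simp [effDom, fY, extendTop, h] at hx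
  coe_f i x hx := by
    refine EReal.coe_toReal (hdom i hx).ne ?_
    intro h
    have := (htame i).ne_bot x
    simp [fY, extendTop, hx, h] at this

theorem val_fst (i : Fin n) (x : Vec (d i)) : (P.val i x).fst = (P.f i x).toReal := rfl

theorem val_snd (i : Fin n) (x : Vec (d i)) : (P.val i x).snd = P.g i x := rfl

theorem repPoint_fst (x : ∀ i, Fin (m + 2) → Vec (d i)) (lam : Fin n → Fin (m + 2) → ℝ)
    (w : Vec m) :
    (P.repPoint x lam w).fst = ∑ i, ∑ j, lam i j * (P.f i (x i j)).toReal := by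
  simp [repPoint, WithLp.sum_fst, val_fst]

theorem repPoint_snd (x : ∀ i, Fin (m + 2) → Vec (d i)) (lam : Fin n → Fin (m + 2) → ℝ)
    (w : Vec m) (k : Fin m) :
    (P.repPoint x lam w).snd k = ∑ i, ∑ j, lam i j * P.g i (x i j) k - P.b k + w k := by
  simp only [repPoint, WithLp.add_snd, WithLp.sum_snd, WithLp.smul_snd, val_snd, WithLp.toLp_snd,
    PiLp.add_apply, PiLp.neg_apply, WithLp.ofLp_sum, Finset.sum_apply, PiLp.smul_apply, smul_eq_mul]
  ring

namespace IsRegular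

theorem sum_f (hP : P.IsRegular) {x : ∀ i, Vec (d i)} (hx : ∀ i, x i ∈ P.Y i) :
    ∑ i, P.f i (x i) = ((∑ i, (P.f i (x i)).toReal : ℝ) : EReal) := by
  rw [EReal.coe_fintype_sum]
  exact Finset.sum_congr rfl fun i _ => (hP.coe_f i _ (hx i)).symm

theorem lowerSemicontinuous_toReal (hP : P.IsRegular) (i : Fin n) :
    LowerSemicontinuous fun x : P.Y i => (P.f i x).toReal := by
  intro x r hr
  have h1 : (r : EReal) < P.f i x := by
    rw [← hP.coe_f i x x.2]
    exact_mod_cast hr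
  filter_upwards [(continuous_subtype_val.tendsto x).eventually (hP.lsc_f i x r h1)] with y hy
  have hy' : (r : EReal) < P.f i y := hy
  rw [← hP.coe_f i y y.2] at hy'
  exact_mod_cast hy'

theorem exists_le_f (hP : P.IsRegular) : ∃ B : ℝ, ∀ i, ∀ x ∈ P.Y i, B ≤ (P.f i x).toReal := by
  have h : ∀ i, ∃ B : ℝ, ∀ x ∈ P.Y i, B ≤ (P.f i x).toReal := by
    intro i
    have := isCompact_iff_compactSpace.1 (hP.isCompact i)
    obtain ⟨B, hB⟩ := ((hP.lowerSemicontinuous_toReal i).lowerSemicontinuousOn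
      Set.univ).bddBelow_of_isCompact isCompact_univ
    exact ⟨B, fun x hx => hB ⟨⟨x, hx⟩, trivial, rfl⟩⟩
  choose B hB using h
  obtain ⟨C, hC⟩ := (Set.finite_range B).bddBelow
  exact ⟨C, fun i x hx => (hC ⟨i, rfl⟩).trans (hB i x hx)⟩

theorem exists_le_g (hP : P.IsRegular) :
    ∃ B : ℝ, ∀ i, ∀ x ∈ P.Y i, ∀ k, B ≤ P.g i x k := by
  have h : ∀ q : Fin n × Fin m, ∃ B : ℝ, ∀ x ∈ P.Y q.1, B ≤ P.g q.1 x q.2 := by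
    intro q
    obtain ⟨B, hB⟩ :=
      ((hP.lsc_g q.1 q.2).lowerSemicontinuousOn _).bddBelow_of_isCompact (hP.isCompact q.1)
    exact ⟨B, fun x hx => hB ⟨x, hx, rfl⟩⟩
  choose B hB using h
  obtain ⟨C, hC⟩ := (Set.finite_range B).bddBelow
  exact ⟨C, fun i x hx k => (hC ⟨(i, k), rfl⟩).trans (hB (i, k) x hx)⟩

/-! ### The value function and the Lagrange dual -/

/-- For fixed `x`, the best perturbation against a multiplier `lam ≥ 0` is the smallest one for
which `x` is feasible, namely `u = ∑ᵢ gᵢ(xᵢ) - b`; the supremum over `u` then becomes the infimum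
defining `Psi`. -/
theorem fenchelConj_hcP_neg (hP : P.IsRegular) {lam : Vec m} (hlam : ∀ k, 0 ≤ lam k) :
    fenchelConj P.hcP (-lam) = -P.Psi lam := by
  apply le_antisymm
  · refine iSup_le fun u => ?_
    have h : P.Psi lam + ((inner ℝ (-lam) u : ℝ) : EReal) ≤ P.hcP u := by
      refine le_iInf₂ fun x hx => ?_
      have h1 : P.Psi lam ≤ _ := iInf₂_le x hx.1
      rw [hP.sum_f hx.1, ← EReal.coe_add] at h1
      rw [hP.sum_f hx.1]
      refine (add_le_add_left h1 _).trans ?_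
      rw [← EReal.coe_add, EReal.coe_le_coe_iff]
      have h2 : ∑ k, lam k * (∑ i, P.g i (x i) k - P.b k) ≤ ∑ k, lam k * u k :=
        Finset.sum_le_sum fun k _ => mul_le_mul_of_nonneg_left (hx.2 k) (hlam k)
      have h3 : inner ℝ (-lam) u = - ∑ k, lam k * u k := by
        simp [PiLp.inner_apply, mul_comm]
      linarith
    calc ((inner ℝ (-lam) u : ℝ) : EReal) - P.hcP u
        ≤ ((inner ℝ (-lam) u : ℝ) : EReal) - (P.Psi lam + ((inner ℝ (-lam) u : ℝ) : EReal)) :=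
          EReal.sub_le_sub le_rfl h
      _ = -P.Psi lam := EReal.sub_add_cancel_right
  · rw [EReal.neg_le]
    refine le_iInf₂ fun x hx => ?_
    rw [EReal.neg_le]
    set u : Vec m := WithLp.toLp 2 fun k => ∑ i, P.g i (x i) k - P.b k with hu
    have h1 : P.hcP u ≤ _ := iInf₂_le x ⟨hx, fun k => le_rfl⟩
    have h2 : ((inner ℝ (-lam) u : ℝ) : EReal) - P.hcP u ≤ fenchelConj P.hcP (-lam) :=
      le_iSup (fun u => ((inner ℝ (-lam) u : ℝ) : EReal) - P.hcP u) u
    refine le_trans ?_ ((EReal.sub_le_sub le_rfl h1).trans h2)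
    rw [hP.sum_f hx, ← EReal.coe_add, ← EReal.coe_neg, ← EReal.coe_sub, EReal.coe_le_coe_iff]
    have h3 : inner ℝ (-lam) u = - ∑ k, lam k * (∑ i, P.g i (x i) k - P.b k) := by
      simp [PiLp.inner_apply, mul_comm, hu]
    linarith

/-- Raising `u k` only relaxes the constraints, so `hcP` stays bounded above while the linear term
tends to infinity. -/
theorem fenchelConj_hcP_eq_top (hP : P.IsRegular) {y : Vec m} {k : Fin m} (hk : 0 < y k) :
    fenchelConj P.hcP y = ⊤ := by
  rw [EReal.eq_top_iff_forall_lt]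
  intro r
  choose x hx using hP.nonempty
  set F := ∑ i, (P.f i (x i)).toReal
  set u₀ : Vec m := WithLp.toLp 2 fun k => ∑ i, P.g i (x i) k - P.b k with hu₀
  set t : ℝ := (|r + 1 + F - inner ℝ y u₀|) / y k with ht
  have ht0 : 0 ≤ t := by positivity
  set u : Vec m := u₀ + EuclideanSpace.single k t with hu
  have h1 : P.hcP u ≤ ∑ i, P.f i (x i) := by
    refine iInf₂_le x ⟨hx, fun l => ?_⟩
    simp only [hu, hu₀, PiLp.add_apply, PiLp.single_apply]
    split_ifs <;> linarith
  rw [hP.sum_f hx] at h1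
  have h2 : ((inner ℝ y u : ℝ) : EReal) - P.hcP u ≤ fenchelConj P.hcP y :=
    le_iSup (fun u => ((inner ℝ y u : ℝ) : EReal) - P.hcP u) u
  refine lt_of_lt_of_le ?_ ((EReal.sub_le_sub le_rfl h1).trans h2)
  rw [← EReal.coe_sub, EReal.coe_lt_coe_iff]
  have h3 : inner ℝ y u = inner ℝ y u₀ + t * y k := by
    rw [hu, inner_add_right, EuclideanSpace.inner_single_right]
    simp
  have h4 : t * y k = |r + 1 + F - inner ℝ y u₀| := by
    rw [ht]
    field_simp
  have := le_abs_self (r + 1 + F - inner ℝ y u₀)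
  linarith

theorem hcD_zero (hP : P.IsRegular) : P.hcD 0 = P.dualValue := by
  apply le_antisymm
  · refine iSup_le fun y => ?_
    rw [inner_zero_left, EReal.coe_zero, zero_sub]
    by_cases hy : ∀ k, y k ≤ 0
    · have hlam : ∀ k, 0 ≤ (-y) k := fun k => by simpa using hy k
      have h := hP.fenchelConj_hcP_neg hlam
      rw [neg_neg] at h
      rw [h, neg_neg]
      exact le_iSup₂ (f := fun (lam : Vec m) (_ : ∀ k, 0 ≤ lam k) => P.Psi lam) (-y) hlam
    · push Not at hy
      obtain ⟨k, hk⟩ := hy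
      simp [hP.fenchelConj_hcP_eq_top hk]
  · refine iSup₂_le fun lam hlam => ?_
    have h : ((inner ℝ (0 : Vec m) (-lam) : ℝ) : EReal) - fenchelConj P.hcP (-lam) ≤ P.hcD 0 :=
      le_iSup (fun y => ((inner ℝ (0 : Vec m) y : ℝ) : EReal) - fenchelConj P.hcP y) (-lam)
    rwa [inner_zero_left, EReal.coe_zero, zero_sub, hP.fenchelConj_hcP_neg hlam, neg_neg] at h

theorem dualValue_ne_bot (hP : P.IsRegular) : P.dualValue ≠ ⊥ := by
  obtain ⟨B, hB⟩ := hP.exists_le_f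
  have h : ((n * B : ℝ) : EReal) ≤ P.dualValue := by
    refine le_trans ?_ (le_iSup₂ (f := fun (lam : Vec m) (_ : ∀ k, 0 ≤ lam k) => P.Psi lam) 0
      fun k => by simp)
    refine le_iInf₂ fun x hx => ?_
    rw [hP.sum_f hx, ← EReal.coe_add, EReal.coe_le_coe_iff]
    have : ∑ _i : Fin n, B ≤ ∑ i, (P.f i (x i)).toReal :=
      Finset.sum_le_sum fun i _ => hB i _ (hx i)
    simpa using this
  exact fun h' => EReal.coe_ne_bot _ (le_bot_iff.1 (h' ▸ h))

/-- Weak duality: the inequality defines a closed half-space which contains the epigraph, hence also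
its closed convex hull. -/
theorem le_lagrangian_of_mem_epiHull {lam : Vec m} (hlam : ∀ k, 0 ≤ lam k)
    {r : ℝ} (hr : (r : EReal) ≤ P.Psi lam) {z : ValSpace m} (hz : z ∈ P.epiHull) :
    r ≤ z.fst + ∑ k, lam k * z.snd k := by
  have h1 : Continuous fun z : ValSpace m => z.fst + ∑ k, lam k * z.snd k := by
    have := WithLp.continuous_fst 2 (α := ℝ) (β := Vec m)
    have := WithLp.continuous_snd 2 (α := ℝ) (β := Vec m)
    fun_prop
  have h2 : Convex ℝ {z : ValSpace m | r ≤ z.fst + ∑ k, lam k * z.snd k} := by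
    refine convex_halfSpace_ge (f := fun z : ValSpace m => z.fst + ∑ k, lam k * z.snd k)
      ⟨fun z z' => ?_, fun c z => ?_⟩ r
    · simp only [WithLp.add_fst, WithLp.add_snd, PiLp.add_apply, mul_add, Finset.sum_add_distrib]
      ring
    · simp only [WithLp.smul_fst, WithLp.smul_snd, PiLp.smul_apply, smul_eq_mul, mul_add,
        Finset.mul_sum]
      congr 1
      exact Finset.sum_congr rfl fun k _ => by ring
  refine closure_minimal (convexHull_min ?_ h2) (isClosed_le continuous_const h1) hz
  rintro z ⟨x, hx, hf, hg⟩
  have h3 := hr.trans (iInf₂_le x hx)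
  have h4 := h3.trans (add_le_add_left hf _)
  rw [← EReal.coe_add, EReal.coe_le_coe_iff] at h4
  refine h4.trans ?_
  gcongr with k
  · exact hlam k
  · exact hg k

/-- Strong duality by separation. The functional `(a, ν)` strictly separating the point has `a ≥ 0`
and `ν ≥ 0`. If `a > 0`, the multiplier `ν / a` has dual value above `r`; if `a = 0`, large
multiples of `ν` do. -/
theorem mem_epiHull (hP : P.IsRegular) {r : ℝ} (hr : (r : EReal) = P.dualValue) :
    (WithLp.toLp 2 (r, 0) : ValSpace m) ∈ P.epiHull := by
  by_contra hcon
  obtain ⟨F, v, hF1, hF2⟩ := geometric_hahn_banach_point_closed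
    (convex_convexHull ℝ P.epiSet).closure isClosed_closure hcon
  set a := F (WithLp.toLp 2 (1, 0)) with ha
  set ν : Vec m := WithLp.toLp 2 fun k => F (WithLp.toLp 2 (0, EuclideanSpace.single k 1)) with hν
  have hF : ∀ z : ValSpace m, F z = a * z.fst + ∑ k, ν k * z.snd k := by
    intro z
    have hz : z = z.fst • (WithLp.toLp 2 (1, 0) : ValSpace m)
        + ∑ k, z.snd k • (WithLp.toLp 2 (0, EuclideanSpace.single k 1) : ValSpace m) := by
      refine WithLp.ofLp_injective 2 (Prod.ext ?_ ?_)
      · simp [Prod.fst_sum]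
      · ext k
        simp [Prod.snd_sum, Finset.sum_apply, Pi.single_apply]
    conv_lhs => rw [hz]
    simp only [map_add, map_smul, map_sum, smul_eq_mul, ha, hν]
    congr 1
    · ring
    · exact Finset.sum_congr rfl fun k _ => by ring
  have hlow : ∀ x : ∀ i, Vec (d i), (∀ i, x i ∈ P.Y i) → ∀ s : ℝ, 0 ≤ s → ∀ t : Vec m,
      (∀ k, 0 ≤ t k) → v < a * (∑ i, (P.f i (x i)).toReal + s)
        + ∑ k, ν k * (∑ i, P.g i (x i) k - P.b k + t k) := by
    intro x hx s hs t ht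
    have hmem : (WithLp.toLp 2 (∑ i, (P.f i (x i)).toReal + s,
        WithLp.toLp 2 fun k => ∑ i, P.g i (x i) k - P.b k + t k) : ValSpace m) ∈ P.epiSet := by
      refine ⟨x, hx, ?_, fun k => ?_⟩
      · rw [hP.sum_f hx, EReal.coe_le_coe_iff]
        simpa using hs
      · simpa using ht k
    have := hF2 _ (subset_closure (subset_convexHull ℝ _ hmem))
    rw [hF] at this
    simpa using this
  obtain ⟨B, hB⟩ := hP.exists_le_f
  choose x₀ hx₀ using hP.nonempty
  set L₀ := a * (∑ i, (P.f i (x₀ i)).toReal) + ∑ k, ν k * (∑ i, P.g i (x₀ i) k - P.b k) with hL₀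
  -- The epigraph is closed under increasing any coordinate, so a negative coefficient would make
  -- the functional unbounded below on it.
  have hunb : ∀ c : ℝ, (∀ s : ℝ, 0 ≤ s → v < L₀ + c * s) → 0 ≤ c := by
    intro c h
    by_contra! hc
    have h1 := h (|L₀ - v| / (-c)) (div_nonneg (abs_nonneg _) (by linarith))
    have h2 : c * (|L₀ - v| / (-c)) = -|L₀ - v| := by
      have := hc.ne
      field_simp
    rw [h2] at h1
    have := le_abs_self (L₀ - v)
    linarith
  have ha0 : 0 ≤ a := by
    refine hunb a fun s hs => ?_
    have := hlow x₀ hx₀ s hs 0 (by simp)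
    simp only [PiLp.zero_apply, add_zero] at this
    rw [hL₀]
    linarith
  have hν0 : ∀ k, 0 ≤ ν k := by
    intro k
    refine hunb (ν k) fun s hs => ?_
    have := hlow x₀ hx₀ 0 le_rfl (EuclideanSpace.single k s) (fun l => by
      simp only [PiLp.single_apply]
      split_ifs <;> simp [hs])
    simp only [PiLp.single_apply, mul_add, Finset.sum_add_distrib, mul_ite,
      mul_zero, Finset.sum_ite_eq', Finset.mem_univ, if_true, add_zero] at this
    simp only [hL₀]
    linarith
  rw [hF] at hF1
  simp only [WithLp.toLp_fst, WithLp.toLp_snd, PiLp.zero_apply, mul_zero,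
    Finset.sum_const_zero, add_zero] at hF1
  have hlow' : ∀ x : ∀ i, Vec (d i), (∀ i, x i ∈ P.Y i) → v < a * (∑ i, (P.f i (x i)).toReal)
        + ∑ k, ν k * (∑ i, P.g i (x i) k - P.b k) := by
    intro x hx
    simpa using hlow x hx 0 le_rfl 0 (by simp)
  have hbound : ∀ (lam : Vec m) (r' : ℝ), (∀ k, 0 ≤ lam k) →
      (∀ x : ∀ i, Vec (d i), (∀ i, x i ∈ P.Y i) → r' ≤ ∑ i, (P.f i (x i)).toReal
        + ∑ k, lam k * (∑ i, P.g i (x i) k - P.b k)) → r' ≤ r := by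
    intro lam r' hlam h
    have h1 : (r' : EReal) ≤ P.Psi lam := by
      refine le_iInf₂ fun x hx => ?_
      rw [hP.sum_f hx, ← EReal.coe_add, EReal.coe_le_coe_iff]
      exact h x hx
    have h2 := h1.trans
      (le_iSup₂ (f := fun (lam : Vec m) (_ : ∀ k, 0 ≤ lam k) => P.Psi lam) lam hlam)
    change _ ≤ P.dualValue at h2
    rw [← hr] at h2
    exact_mod_cast h2
  rcases ha0.eq_or_lt with ha' | ha'
  · rw [← ha', zero_mul] at hF1
    have hfB : ∀ x : ∀ i, Vec (d i), (∀ i, x i ∈ P.Y i) →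
        n * B ≤ ∑ i, (P.f i (x i)).toReal := by
      intro x hx
      have : ∑ _i : Fin n, B ≤ ∑ i, (P.f i (x i)).toReal :=
        Finset.sum_le_sum fun i _ => hB i _ (hx i)
      simpa using this
    -- Here `v > 0`, since the functional vanishes at the separated point. As `n * B` bounds the
    -- objective below, this `T` makes the Lagrangian with multiplier `T • ν` at least `r + 1`.
    set T := (|r + 1 - n * B|) / v with hT
    have hT0 : 0 ≤ T := by positivity
    have := hbound (T • ν) (r + 1) (fun k => by simpa using mul_nonneg hT0 (hν0 k)) (by
      intro x hx
      have h1 := hlow' x hx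
      rw [← ha', zero_mul, zero_add] at h1
      have h2 := hfB x hx
      have h3 : ∑ k, (T • ν) k * (∑ i, P.g i (x i) k - P.b k)
          = T * ∑ k, ν k * (∑ i, P.g i (x i) k - P.b k) := by
        rw [Finset.mul_sum]
        exact Finset.sum_congr rfl fun k _ => by simp only [PiLp.smul_apply, smul_eq_mul]; ring
      have h4 : T * v = |r + 1 - n * B| := by
        rw [hT]
        field_simp
      have h5 := mul_le_mul_of_nonneg_left h1.le hT0
      have := le_abs_self (r + 1 - n * B)
      linarith)
    linarith
  · have := hbound (a⁻¹ • ν) (v / a) (fun k => by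
      simpa using mul_nonneg (inv_nonneg.2 ha'.le) (hν0 k)) (by
      intro x hx
      have h1 := hlow' x hx
      have h3 : ∑ k, (a⁻¹ • ν) k * (∑ i, P.g i (x i) k - P.b k)
          = a⁻¹ * ∑ k, ν k * (∑ i, P.g i (x i) k - P.b k) := by
        rw [Finset.mul_sum]
        exact Finset.sum_congr rfl fun k _ => by simp only [PiLp.smul_apply, smul_eq_mul]; ring
      rw [h3, div_le_iff₀ ha']
      have : (∑ i, (P.f i (x i)).toReal + a⁻¹ * ∑ k, ν k * (∑ i, P.g i (x i) k - P.b k)) * a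
        = a * (∑ i, (P.f i (x i)).toReal) + ∑ k, ν k * (∑ i, P.g i (x i) k - P.b k) := by
        field_simp
      linarith)
    rw [div_le_iff₀ ha'] at this
    linarith

end IsRegular

end SepProblem

/-! ### Representations of points of the closed convex hull -/

namespace SepProblem

open Module

variable {n m : ℕ} {d : Fin n → ℕ} {P : SepProblem n m d}

theorem finrank_valSpace (m : ℕ) : finrank ℝ (ValSpace m) = m + 1 := by
  rw [(WithLp.linearEquiv 2 ℝ (ℝ × Vec m)).finrank_eq, finrank_prod, finrank_euclideanSpace_fin,
    finrank_self, add_comm]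

theorem one_le_card_of_sum_eq_one {ι : Type*} [Fintype ι] {w : ι → ℝ} (h : ∑ j, w j = 1) :
    1 ≤ Finset.card {j | w j ≠ 0} := by
  rw [Nat.one_le_iff_ne_zero, Finset.card_ne_zero]
  by_contra h0
  rw [Finset.not_nonempty_iff_eq_empty, Finset.filter_eq_empty_iff] at h0
  simp only [not_not] at h0
  simp [h0] at h

/-- Convex combinations of the values of `P` have representations with few nonzero weights. -/
theorem exists_isRep {T : Type*} [Fintype T] [Nonempty T] (y : ∀ i, T → Vec (d i))
    (hy : ∀ i t, y i t ∈ P.Y i) (μ : Fin n → T → ℝ) (hμ : ∀ i t, 0 ≤ μ i t)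
    (hsum : ∀ i, ∑ t, μ i t = 1) :
    ∃ (x : ∀ i, Fin (m + 2) → Vec (d i)) (lam : Fin n → Fin (m + 2) → ℝ),
      P.IsRep x lam ∧ totalCard lam ≤ n + m + 1 ∧
      ∑ i, ∑ j, lam i j • P.val i (x i j) = ∑ i, ∑ t, μ i t • P.val i (y i t) := by
  obtain ⟨α, h0, h1, h2, h3⟩ := shapleyFolkman (fun i t => P.val i (y i t)) μ hμ hsum
  rw [finrank_valSpace] at h3
  have hcard : ∀ i, Finset.card {t | α i t ≠ 0} ≤ m + 2 := by
    intro i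
    -- Each other row uses at least one of the `n + m + 1` nonzero weights, which leaves at most `m
    -- + 2` for row `i`.
    have h4 : n - 1 ≤ ∑ i' ∈ Finset.univ.erase i, Finset.card {t | α i' t ≠ 0} := by
      calc n - 1 = ∑ i' ∈ Finset.univ.erase i, 1 := by simp
        _ ≤ _ := Finset.sum_le_sum fun i' _ => one_le_card_of_sum_eq_one (h1 i')
    rw [← Finset.add_sum_erase _ _ (Finset.mem_univ i)] at h3
    have := i.pos
    omega
  choose τ ν g0 g1 g2 using fun i => exists_reindex (α i) (hcard i)
  refine ⟨fun i j => y i (τ i j), ν, ⟨fun i j => hy _ _, fun i => g0 i (h0 i), fun i => ?_⟩, ?_, ?_⟩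
  · have := g2 i (fun _ => (1 : ℝ))
    simpa [h1 i] using this
  · rw [totalCard]
    simp only [ncard_ne_zero_eq, g1]
    omega
  · rw [← h2]
    exact Finset.sum_congr rfl fun i _ => g2 i fun t => P.val i (y i t)

/-- Choosing one point in each row independently, with the row weights as probabilities, gives a
random point of the epigraph whose expectation is the representation point. -/
theorem repPoint_mem_epiHull (hP : P.IsRegular) {x : ∀ i, Fin (m + 2) → Vec (d i)}
    {lam : Fin n → Fin (m + 2) → ℝ} (h : P.IsRep x lam) :
    P.repPoint x lam 0 ∈ P.epiHull := by
  classical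
  apply subset_closure
  refine mem_convexHull_of_exists_fintype (fun κ : Fin n → Fin (m + 2) => ∏ i, lam i (κ i))
    (fun κ => ∑ i, P.val i (x i (κ i)) + WithLp.toLp 2 (0, -P.b))
    (fun κ => Finset.prod_nonneg fun _ _ => h.2.1 _ _) ?_ ?_ ?_
  · rw [← Fintype.prod_sum]
    exact Finset.prod_eq_one fun i _ => h.2.2 i
  · intro κ
    refine ⟨fun i => x i (κ i), fun i => h.1 _ _, ?_, fun k => ?_⟩
    · rw [hP.sum_f fun i => h.1 _ _]
      simp [WithLp.sum_fst, val_fst]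
    · simp [WithLp.sum_snd, val_snd, sub_eq_add_neg]
  · have hp : ∑ κ : Fin n → Fin (m + 2), ∏ i, lam i (κ i) = 1 := by
      rw [← Fintype.prod_sum]
      exact Finset.prod_eq_one fun i _ => h.2.2 i
    simp only [smul_add, Finset.sum_add_distrib, ← Finset.sum_smul, hp, one_smul]
    rw [repPoint, add_zero]
    congr 1
    simp only [Finset.smul_sum]
    rw [Finset.sum_comm]
    refine Finset.sum_congr rfl fun i _ => ?_
    -- The `i`-th marginal of the product weights is row `i`.
    have key : ∀ j, ∑ κ : Fin n → Fin (m + 2), (if κ i = j then ∏ i, lam i (κ i) else 0)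
        = lam i j := by
      intro j
      have e : ∀ κ : Fin n → Fin (m + 2), (if κ i = j then ∏ i, lam i (κ i) else 0)
          = ∏ i', (if i' = i then (if κ i' = j then lam i' (κ i') else 0) else lam i' (κ i')) := by
        intro κ
        split_ifs with hj
        · refine Finset.prod_congr rfl fun i' _ => ?_
          split_ifs with h1 h2
          · rfl
          · exact absurd (h1 ▸ hj) h2
          · rfl
        · symm
          apply Finset.prod_eq_zero (Finset.mem_univ i)
          simp [hj]
      simp only [e]
      rw [← Fintype.prod_sum (fun i' l =>
        if i' = i then (if l = j then lam i' l else 0) else lam i' l)]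
      rw [Finset.prod_eq_single i]
      · simp
      · intro i' _ hi'
        simp [hi', h.2.2]
      · simp
    calc ∑ κ : Fin n → Fin (m + 2), (∏ i, lam i (κ i)) • P.val i (x i (κ i))
        = ∑ κ : Fin n → Fin (m + 2), ∑ j, (if κ i = j then ∏ i, lam i (κ i) else 0) •
            P.val i (x i j) := by
          refine Finset.sum_congr rfl fun κ _ => ?_
          simp [ite_smul]
      _ = ∑ j, lam i j • P.val i (x i j) := by
          rw [Finset.sum_comm]
          refine Finset.sum_congr rfl fun j _ => ?_
          rw [← Finset.sum_smul, key]

/-- Representations form a compact set, a product of copies of the `Yᵢ` and of simplices. Each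
coordinate of the representation point is lower semicontinuous there, because `fᵢ` and `gᵢ` are
bounded below on `Yᵢ`. In `Option (Fin m)`, `none` stands for the objective. -/
theorem isClosed_upper_repPoint (hP : P.IsRegular) :
    IsClosed {z : ValSpace m | ∃ x lam, P.IsRep x lam ∧ (P.repPoint x lam 0).fst ≤ z.fst ∧
      ∀ k, (P.repPoint x lam 0).snd k ≤ z.snd k} := by
  let K : Set ((∀ i, Fin (m + 2) → Vec (d i)) × (Fin n → Fin (m + 2) → ℝ)) :=
    (Set.univ.pi fun i => Set.univ.pi fun _ => P.Y i) ×ˢ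
      (Set.univ.pi fun _ => stdSimplex ℝ (Fin (m + 2)))
  have hK : IsCompact K := (isCompact_univ_pi fun i => isCompact_univ_pi fun _ =>
    hP.isCompact i).prod (isCompact_univ_pi fun _ => isCompact_stdSimplex ℝ _)
  have hmem : ∀ p, p ∈ K ↔ P.IsRep p.1 p.2 := by
    intro p
    simp only [K, Set.mem_prod, Set.mem_pi, Set.mem_univ, true_imp_iff, stdSimplex, IsRep,
      Set.mem_ofPred_eq, forall_and]
  have := isCompact_iff_compactSpace.1 hK
  obtain ⟨Bf, hBf⟩ := hP.exists_le_f
  obtain ⟨Bg, hBg⟩ := hP.exists_le_g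
  have hY : ∀ (p : K) i j, p.1.1 i j ∈ P.Y i := fun p => ((hmem _).1 p.2).1
  have hw : ∀ (p : K) i j, 0 ≤ p.1.2 i j := fun p => ((hmem _).1 p.2).2.1
  let Φ : Option (Fin m) → K → ℝ := fun o p => o.elim
    (∑ i, ∑ j, p.1.2 i j * (P.f i (p.1.1 i j)).toReal)
    fun k => ∑ i, ∑ j, p.1.2 i j * P.g i (p.1.1 i j) k - P.b k
  have hΦ : ∀ o, LowerSemicontinuous (Φ o) := by
    rintro (_ | k)
    · refine lowerSemicontinuous_sum fun i _ => lowerSemicontinuous_sum fun j _ => ?_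
      refine LowerSemicontinuous.continuous_mul (by fun_prop) (fun p => hw p i j) ?_
        (B := Bf) fun p => hBf i _ (hY p i j)
      have hc : Continuous fun p : K => (⟨p.1.1 i j, hY p i j⟩ : P.Y i) := by fun_prop
      exact fun p r hr =>
        (hc.tendsto p).eventually (hP.lowerSemicontinuous_toReal i ⟨_, hY p i j⟩ r hr)
    · change LowerSemicontinuous fun p : K =>
        ∑ i, ∑ j, p.1.2 i j * P.g i (p.1.1 i j) k - P.b k
      simp only [sub_eq_add_neg]
      refine LowerSemicontinuous.add ?_ lowerSemicontinuous_const
      refine lowerSemicontinuous_sum fun i _ => lowerSemicontinuous_sum fun j _ => ?_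
      refine LowerSemicontinuous.continuous_mul (by fun_prop) (fun p => hw p i j) ?_
        (B := Bg) fun p => hBg i _ (hY p i j) k
      have hc : Continuous fun p : K => p.1.1 i j := by fun_prop
      exact fun p r hr => (hc.tendsto p).eventually (hP.lsc_g i k _ r hr)
  have hcont : Continuous fun (z : ValSpace m) (o : Option (Fin m)) =>
      (o.elim z.fst fun k => z.snd k : ℝ) := by
    have hfst := WithLp.continuous_fst 2 (α := ℝ) (β := Vec m)
    have hsnd := WithLp.continuous_snd 2 (α := ℝ) (β := Vec m)
    refine continuous_pi fun o => ?_
    rcases o with _ | k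
    · exact hfst
    · change Continuous fun z : ValSpace m => z.snd k
      fun_prop
  convert (isClosed_setOf_exists_le hΦ).preimage hcont using 1
  ext z
  simp only [Set.mem_ofPred_eq, Set.mem_preimage, Option.forall, Option.elim, repPoint_fst,
    repPoint_snd, PiLp.zero_apply, add_zero, Φ]
  constructor
  · rintro ⟨x, lam, h1, h2⟩
    exact ⟨⟨(x, lam), (hmem _).2 h1⟩, h2⟩
  · rintro ⟨p, h⟩
    exact ⟨p.1.1, p.1.2, (hmem _).1 p.2, h⟩

/-- A finite convex combination of epigraph points gives a representation with the same weights in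
every row, compressed by `exists_isRep`; closedness of the upper set passes to the closure. -/
theorem exists_repPoint_le (hP : P.IsRegular) {z : ValSpace m} (hz : z ∈ P.epiHull) :
    ∃ x lam, P.IsRep x lam ∧ (P.repPoint x lam 0).fst ≤ z.fst ∧
      ∀ k, (P.repPoint x lam 0).snd k ≤ z.snd k := by
  refine closure_minimal ?_ (isClosed_upper_repPoint hP) hz
  intro z hz
  obtain ⟨T, _, w, p, hw0, hw1, hp, rfl⟩ := mem_convexHull_iff_exists_fintype.1 hz
  choose y hy hf hg using hp
  have : Nonempty T := by
    by_contra h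
    rw [not_nonempty_iff] at h
    simp at hw1
  obtain ⟨x, lam, h1, -, h2⟩ := exists_isRep (P := P) (fun i t => y t i) (fun i t => hy t i)
    (fun _ => w) (fun _ => hw0) fun _ => hw1
  refine ⟨x, lam, h1, ?_, fun k => ?_⟩
  · rw [repPoint, h2]
    simp only [WithLp.add_fst, WithLp.sum_fst, WithLp.smul_fst, val_fst, WithLp.toLp_fst, add_zero,
      smul_eq_mul]
    rw [Finset.sum_comm]
    refine Finset.sum_le_sum fun t _ => ?_
    rw [← Finset.mul_sum]
    have := hf t
    rw [hP.sum_f (hy t), EReal.coe_le_coe_iff] at this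
    exact mul_le_mul_of_nonneg_left this (hw0 t)
  · rw [repPoint, h2]
    simp only [WithLp.add_snd, WithLp.sum_snd, WithLp.smul_snd, val_snd, WithLp.toLp_snd,
      PiLp.add_apply, PiLp.neg_apply, WithLp.ofLp_sum, Finset.sum_apply, PiLp.smul_apply,
      smul_eq_mul, add_zero]
    rw [Finset.sum_comm]
    have hb : -P.b k = ∑ t, w t * -P.b k := by rw [← Finset.sum_mul, hw1, one_mul]
    rw [hb, ← Finset.sum_add_distrib]
    refine Finset.sum_le_sum fun t _ => ?_
    rw [← Finset.mul_sum, ← mul_add]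
    exact mul_le_mul_of_nonneg_left (hg t k) (hw0 t)

/-- Complementary slackness is automatic: weak duality at `z` itself gives `⟨lam, r⟩ ≥ 0`, while the
signs give `⟨lam, r⟩ ≤ 0`. -/
theorem attainsDual_of_le {z : ValSpace m} (hz : z ∈ P.epiHull)
    (hnonpos : ∀ k, z.snd k ≤ 0) (hval : ((z.fst : ℝ) : EReal) = P.dualValue) :
    P.AttainsDual z where
  mem_hull := hz
  nonpos := hnonpos
  value := hval
  lagrangian lam hlam hopt := by
    have h1 : ∀ z' ∈ P.epiHull, z.fst ≤ z'.fst + ∑ k, lam k * z'.snd k := fun z' hz' =>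
      IsRegular.le_lagrangian_of_mem_epiHull hlam (by rw [hopt, hval]) hz'
    have h2 : ∑ k, lam k * z.snd k ≤ 0 :=
      Finset.sum_nonpos fun k _ => mul_nonpos_of_nonneg_of_nonpos (hlam k) (hnonpos k)
    have h3 : ∑ k, lam k * z.snd k = 0 := by
      have := h1 z hz
      linarith
    refine ⟨fun z' hz' => ?_, ?_⟩
    · change z.fst + ∑ k, lam k * z.snd k ≤ z'.fst + ∑ k, lam k * z'.snd k
      rw [h3, add_zero]
      exact h1 z' hz'
    · rw [h3, add_zero, hval, hopt]

theorem exists_attainsDual (hP : P.IsRegular) (htop : P.dualValue ≠ ⊤) :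
    ∃ (x : ∀ i, Fin (m + 2) → Vec (d i)) (lam : Fin n → Fin (m + 2) → ℝ) (w : Vec m),
      P.IsRep x lam ∧ totalCard lam ≤ n + m + 1 ∧ (∀ k, 0 ≤ w k) ∧
      P.AttainsDual (P.repPoint x lam w) := by
  have hr := EReal.coe_toReal htop hP.dualValue_ne_bot
  obtain ⟨y, μ, hμ, h1, h2⟩ := exists_repPoint_le hP (hP.mem_epiHull hr)
  obtain ⟨x, lam, hlam, hcard, hsum⟩ := exists_isRep (P := P) y hμ.1 μ hμ.2.1 hμ.2.2
  have heq : P.repPoint x lam 0 = P.repPoint y μ 0 := by rw [repPoint, repPoint, hsum]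
  rw [← heq] at h1 h2
  refine ⟨x, lam, 0, hlam, hcard, fun k => le_rfl, ?_⟩
  have hmem := repPoint_mem_epiHull hP hlam
  refine attainsDual_of_le hmem h2 (le_antisymm ?_ ?_)
  · rw [← hr]
    exact_mod_cast h1
  -- The objective cannot fall below the dual value: the point is in the hull and its constraint
  -- part is nonpositive, so weak duality applies.
  · refine iSup₂_le fun l hl => ?_
    by_contra! hcon
    obtain ⟨q, hq1, hq2⟩ := EReal.lt_iff_exists_real_btwn.1 hcon
    have h3 := IsRegular.le_lagrangian_of_mem_epiHull hl hq2.le hmem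
    have h4 : ∑ k, l k * (P.repPoint x lam 0).snd k ≤ 0 :=
      Finset.sum_nonpos fun k _ => mul_nonpos_of_nonneg_of_nonpos (hl k) (h2 k)
    have h5 : (P.repPoint x lam 0).fst < q := by exact_mod_cast hq1
    linarith

end SepProblem

/-! ### Nonconvexity measures -/

section Nonconvexity

open Finset Module

variable {d : ℕ} {φ : Vec d → EReal}

/-- In the definition of `rhoK` the number of points is irrelevant. -/
theorem sub_le_rhoK {T : Type*} [Fintype T] [Nonempty T] {k : ℕ} (y : T → Vec d)
    (hy : ∀ t, y t ∈ effDom φ) (μ : T → ℝ) (hμ : ∀ t, 0 ≤ μ t) (hsum : ∑ t, μ t = 1)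
    (hk : #{t | μ t ≠ 0} ≤ k) :
    φ (∑ t, μ t • y t) - ((∑ t, μ t * (φ (y t)).toReal : ℝ) : EReal) ≤ rhoK k φ := by
  classical
  -- Carathéodory with a cost: passing to `d + 1` points keeps the barycentre and does not increase
  -- the average of `φ`, so the difference can only grow, and the support does not.
  obtain ⟨α, h0, h1, h2, h3, h4⟩ := exists_weights_card_le (fun t => (y t, (1 : ℝ)))
    (LinearMap.snd ℝ (Vec d) ℝ) (fun _ => rfl) (fun t => (φ (y t)).toReal) μ hμ
  rw [finrank_prod, finrank_euclideanSpace_fin, finrank_self] at h4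
  have e1 : ∑ t, α t • y t = ∑ t, μ t • y t := by
    simpa [Prod.fst_sum] using congrArg Prod.fst h1
  have e2 : ∑ t, α t = 1 := by
    rw [← hsum]
    simpa [Prod.snd_sum] using congrArg Prod.snd h1
  have hk' : #{t | α t ≠ 0} ≤ k := by
    refine (card_le_card fun t => ?_).trans hk
    simp only [mem_filter, mem_univ, true_and]
    exact fun h h' => h (h3 t h')
  obtain ⟨τ, ν, g0, g1, g2⟩ := exists_reindex α h4
  have e3 : ∑ j, ν j • y (τ j) = ∑ t, μ t • y t := (g2 y).trans e1
  have e4 : ∑ j, ν j * (φ (y (τ j))).toReal = ∑ t, α t * (φ (y t)).toReal :=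
    g2 fun t => (φ (y t)).toReal
  have e5 : ∑ j, ν j = 1 := by
    have := g2 fun _ => (1 : ℝ)
    simpa [e2] using this
  calc φ (∑ t, μ t • y t) - ((∑ t, μ t * (φ (y t)).toReal : ℝ) : EReal)
      ≤ φ (∑ j, ν j • y (τ j)) - ((∑ j, ν j * (φ (y (τ j))).toReal : ℝ) : EReal) := by
        rw [e3, e4]
        exact EReal.sub_le_sub le_rfl (EReal.coe_le_coe_iff.2 h2)
    _ ≤ rhoK k φ := by
        refine le_trans ?_ (le_iSup _ (fun j => y (τ j)))
        refine le_trans ?_ (le_iSup _ ν)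
        refine le_iSup (fun _ => _) (?_ : _ ∧ _ ∧ _ ∧ _)
        refine ⟨fun j => hy _, g0 h0, e5, ?_⟩
        rw [ncard_ne_zero_eq, g1]
        exact hk'

theorem rhoK_nonneg {x : Vec d} (hx : φ x ≠ ⊤) (hx' : φ x ≠ ⊥) {k : ℕ} (hk : 1 ≤ k) :
    0 ≤ rhoK k φ := by
  have := sub_le_rhoK (φ := φ) (k := k) (fun _ : Unit => x) (fun _ => lt_top_iff_ne_top.2 hx)
    (fun _ => 1) (fun _ => zero_le_one) (by simp) (by simpa using hk)
  simpa [EReal.coe_toReal hx hx', EReal.sub_self hx hx'] using this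

/-- Jensen's inequality: the biconjugate is a supremum of affine minorants of `φ`. -/
theorem biconj_le_sum {T : Type*} [Fintype T] (y : T → Vec d) (hy : ∀ t, φ (y t) ≠ ⊤)
    (hy' : ∀ t, φ (y t) ≠ ⊥) (μ : T → ℝ) (hμ : ∀ t, 0 ≤ μ t) (hsum : ∑ t, μ t = 1) :
    biconj φ (∑ t, μ t • y t) ≤ ((∑ t, μ t * (φ (y t)).toReal : ℝ) : EReal) := by
  refine iSup_le fun q => ?_
  have h : ∀ t, ((inner ℝ q (y t) - (φ (y t)).toReal : ℝ) : EReal) ≤ fenchelConj φ q := by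
    intro t
    rw [EReal.coe_sub, EReal.coe_toReal (hy t) (hy' t)]
    exact le_iSup (fun x => ((inner ℝ q x : ℝ) : EReal) - φ x) (y t)
  have hT : Nonempty T := by
    by_contra hT
    rw [not_nonempty_iff] at hT
    simp at hsum
  rcases eq_or_ne (fenchelConj φ q) ⊤ with h1 | h1
  · rw [h1, EReal.sub_top]
    exact bot_le
  have h2 : fenchelConj φ q ≠ ⊥ := fun h2 =>
    EReal.coe_ne_bot _ (le_bot_iff.1 (h2 ▸ h (Classical.arbitrary T)))
  lift fenchelConj φ q to ℝ using ⟨h1, h2⟩ with c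
  rw [← EReal.coe_sub, EReal.coe_le_coe_iff, sum_inner]
  have h3 : c = ∑ t, μ t * c := by rw [← sum_mul, hsum, one_mul]
  rw [h3, ← sum_sub_distrib]
  refine sum_le_sum fun t _ => ?_
  rw [inner_smul_left, real_inner_comm, conj_trivial, ← mul_sub]
  refine mul_le_mul_of_nonneg_left ?_ (hμ t)
  have := EReal.coe_le_coe_iff.1 (h t)
  linarith

end Nonconvexity

/-! ### Recovering a primal point from a representation -/

namespace SepProblem

open Finset

variable {n m : ℕ} {d : Fin n → ℕ} {P : SepProblem n m d}

theorem effDom_fY (hP : P.IsRegular) {i : Fin n} {x : Vec (d i)} :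
    x ∈ effDom (P.fY i) ↔ x ∈ P.Y i := by
  constructor
  · intro h
    by_contra h'
    simp [effDom, fY, extendTop, h'] at h
  · intro h
    change P.fY i x < ⊤
    rw [fY, extendTop, if_pos h, ← hP.coe_f i x h]
    exact EReal.coe_lt_top _

theorem fY_eq (hP : P.IsRegular) {i : Fin n} {x : Vec (d i)} (hx : x ∈ P.Y i) :
    P.fY i x = ((P.f i x).toReal : EReal) := by
  rw [hP.coe_f i x hx, fY, extendTop, if_pos hx]

/-- At the barycentre, `g` exceeds its biconjugate by at most the lack of convexity, and the
biconjugate obeys Jensen's inequality. -/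
theorem g_le_sum_add (hρ : P.rhoBarG ≠ ⊤) {T : Type*} [Fintype T] (i : Fin n) (k : Fin m)
    (y : T → Vec (d i)) (hy : ∀ t, y t ∈ P.Y i) (μ : T → ℝ) (hμ : ∀ t, 0 ≤ μ t)
    (hsum : ∑ t, μ t = 1) (hx : ∑ t, μ t • y t ∈ P.Y i) :
    P.g i (∑ t, μ t • y t) k ≤ ∑ t, μ t * P.g i (y t) k + P.rhoBarG.toReal := by
  have hg : ∀ x ∈ P.Y i, P.gY i k x = ((P.g i x k : ℝ) : EReal) := fun x hx => by
    rw [gY, extendTop, if_pos hx]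
  have h1 := biconj_le_sum (φ := P.gY i k) y (fun t => by rw [hg _ (hy t)]; exact EReal.coe_ne_top _)
    (fun t => by rw [hg _ (hy t)]; exact EReal.coe_ne_bot _) μ hμ hsum
  have h2 : ∑ t, μ t * (P.gY i k (y t)).toReal = ∑ t, μ t * P.g i (y t) k :=
    sum_congr rfl fun t _ => by rw [hg _ (hy t), EReal.toReal_coe]
  rw [h2] at h1
  set x := ∑ t, μ t • y t
  have h3 : P.gY i k x - biconj (P.gY i k) x ≤ P.rhoBarG := by
    refine le_trans ?_ (le_iSup₂ (f := fun i k => rho (P.gY i k)) i k)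
    refine le_iSup₂ (f := fun x (_ : x ∈ effDom (P.gY i k)) => P.gY i k x - biconj (P.gY i k) x)
      x ?_
    change P.gY i k x < ⊤
    rw [hg x hx]
    exact EReal.coe_lt_top _
  have h4 := (EReal.sub_le_sub (le_refl (P.gY i k x)) h1).trans h3
  rw [hg x hx, ← EReal.coe_sub] at h4
  have h5 : P.rhoBarG ≠ ⊥ := fun h => EReal.coe_ne_bot _ (le_bot_iff.1 (h ▸ h4))
  rw [← EReal.coe_toReal hρ h5, EReal.coe_le_coe_iff] at h4
  linarith

theorem rhoBarG_toReal_nonneg (hP : P.IsRegular) (hρ : P.rhoBarG ≠ ⊤) : 0 ≤ P.rhoBarG.toReal := by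
  by_cases h : Nonempty (Fin n × Fin m)
  · obtain ⟨i, k⟩ := h
    obtain ⟨x, hx⟩ := hP.nonempty i
    have := g_le_sum_add hρ i k (fun _ : Unit => x) (fun _ => hx) (fun _ => 1)
      (fun _ => zero_le_one) (by simp) (by simpa using hx)
    simpa using this
  -- Over no pairs `(i, k)` the supremum in `EReal` is `⊥`, whose `toReal` is the conventional `0`.
  · have h' : P.rhoBarG = ⊥ := by
      simp only [rhoBarG, iSup_eq_bot]
      exact fun i k => absurd ⟨(i, k)⟩ h
    simp [h']

/-- The barycentres of the rows are the primal point. A row with a single nonzero weight is its own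
barycentre, so only the rows counted in `hrows` lose `rhoBarG`; the signs of `w` and `z.snd` absorb
the remaining terms of the constraint. -/
theorem hcP_shift_le (hP : P.IsRegular) (hρ : P.rhoBarG ≠ ⊤)
    {y : ∀ i, Fin (m + 2) → Vec (d i)} {μ : Fin n → Fin (m + 2) → ℝ} {w : Vec m} {z : ValSpace m}
    {s : ℝ} (hrep : P.IsRep y μ) (hw : ∀ k, 0 ≤ w k)
    (hrows : #{i | 2 ≤ #{j | μ i j ≠ 0}} ≤ m + 1) (hs : (totalCard μ : ℝ) ≤ s)
    (hz : ∀ k, z.snd k ≤ 0) :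
    P.hcP (P.shift (P.repPoint y μ w - z).snd) ≤
      ((z.fst : ℝ) : EReal) + (((|(P.repPoint y μ w - z).fst| : ℝ) : EReal) + P.maxRho s) := by
  obtain ⟨hy, hμ, hsum⟩ := hrep
  rcases eq_or_ne (P.maxRho s) ⊤ with htop | htop
  · simp [htop]
  set β : Fin n → ℕ := fun i => #{j | μ i j ≠ 0} with hβ
  have hβ1 : ∀ i, 1 ≤ β i := fun i => one_le_card_of_sum_eq_one (hsum i)
  have hβs : ∑ i, rhoK (β i) (P.fY i) ≤ P.maxRho s := by
    refine le_iSup₂ (f := fun (β : Fin n → ℕ) (_ : (∀ i, 1 ≤ β i ∧ β i ≤ m + 2) ∧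
      ((∑ i, β i : ℕ) : ℝ) ≤ s) => ∑ i, rhoK (β i) (P.fY i)) β ⟨fun i => ⟨hβ1 i, ?_⟩, ?_⟩
    · exact (card_le_univ _).trans (by simp)
    · rw [totalCard] at hs
      simpa only [ncard_ne_zero_eq] using hs
  have hρ0 : ∀ i, 0 ≤ rhoK (β i) (P.fY i) := by
    intro i
    obtain ⟨x, hx⟩ := hP.nonempty i
    refine rhoK_nonneg (x := x) ?_ ?_ (hβ1 i) <;> rw [fY_eq hP hx]
    · exact EReal.coe_ne_top _
    · exact EReal.coe_ne_bot _
  have hρi : ∀ i, ((rhoK (β i) (P.fY i)).toReal : EReal) = rhoK (β i) (P.fY i) := by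
    intro i
    refine EReal.coe_toReal (fun h => htop ?_) (fun h => ?_)
    · rw [← top_le_iff, ← h]
      exact (single_le_sum (f := fun i => rhoK (β i) (P.fY i)) (fun i _ => hρ0 i)
        (mem_univ i)).trans hβs
    · have := hρ0 i
      simp [h] at this
  set r : Fin n → ℝ := fun i => (rhoK (β i) (P.fY i)).toReal with hr
  have hrs : ((∑ i, r i : ℝ) : EReal) ≤ P.maxRho s := by
    rw [EReal.coe_fintype_sum]
    simpa only [hr, hρi] using hβs
  set x : ∀ i, Vec (d i) := fun i => ∑ j, μ i j • y i j with hx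
  have hfx : ∀ i, P.fY i (x i) ≤ ((∑ j, μ i j * (P.f i (y i j)).toReal + r i : ℝ) : EReal) := by
    intro i
    have h := sub_le_rhoK (φ := P.fY i) (k := β i) (y i)
      (fun j => (effDom_fY hP).2 (hy i j)) (μ i) (hμ i) (hsum i) le_rfl
    have e : ∑ j, μ i j * (P.fY i (y i j)).toReal = ∑ j, μ i j * (P.f i (y i j)).toReal :=
      sum_congr rfl fun j _ => by rw [fY_eq hP (hy i j), EReal.toReal_coe]
    rw [e, ← hρi] at h
    rw [add_comm, EReal.coe_add]
    exact (EReal.sub_le_iff_le_add (.inl (EReal.coe_ne_bot _)) (.inl (EReal.coe_ne_top _))).1 h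
  -- `Yᵢ` need not be convex: the barycentre lies in it because a finite `rhoK` keeps `fᵢ + 𝟏_{Yᵢ}`
  -- finite there.
  have hxY : ∀ i, x i ∈ P.Y i := fun i =>
    (effDom_fY hP).1 ((hfx i).trans_lt (EReal.coe_lt_top _))
  have hR := rhoBarG_toReal_nonneg hP hρ
  set R := P.rhoBarG.toReal with hRdef
  have hg : ∀ i k, P.g i (x i) k ≤ ∑ j, μ i j * P.g i (y i j) k +
      if 2 ≤ #{j | μ i j ≠ 0} then R else 0 := by
    intro i k
    split_ifs with h
    · exact g_le_sum_add hρ i k (y i) (hy i) (μ i) (hμ i) (hsum i) (hxY i)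
    · have h1 : #{j | μ i j ≠ 0} = 1 := le_antisymm (by omega) (hβ1 i)
      obtain ⟨j₀, hj₀⟩ := card_eq_one.1 h1
      have h2 : ∀ j, j ≠ j₀ → μ i j = 0 := by
        intro j hj
        by_contra h3
        have : j ∈ ({j | μ i j ≠ 0} : Finset (Fin (m + 2))) := by simpa using h3
        rw [hj₀, mem_singleton] at this
        exact hj this
      have h3 : μ i j₀ = 1 := by
        rw [← hsum i, sum_eq_single j₀ (fun j _ hj => h2 j hj) (by simp)]
      have h4 : x i = y i j₀ := by
        simp only [hx]
        rw [sum_eq_single j₀ (fun j _ hj => by rw [h2 j hj, zero_smul]) (by simp), h3, one_smul]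
      rw [sum_eq_single j₀ (fun j _ hj => by rw [h2 j hj, zero_mul]) (by simp), h3, h4]
      simp
  have hfeas : ∀ k, ∑ i, P.g i (x i) k - P.b k ≤ P.shift (P.repPoint y μ w - z).snd k := by
    intro k
    have h1 : ∑ i, P.g i (x i) k ≤ ∑ i, ∑ j, μ i j * P.g i (y i j) k + (m + 1) * R := by
      refine (sum_le_sum fun i _ => hg i k).trans ?_
      rw [sum_add_distrib, ← sum_filter, sum_const, nsmul_eq_mul]
      have := (Nat.cast_le (α := ℝ)).2 hrows
      rw [Nat.cast_add, Nat.cast_one] at this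
      gcongr
    have h2 : P.shift (P.repPoint y μ w - z).snd k
        = (P.repPoint y μ w).snd k - z.snd k + (m + 1) * R := rfl
    rw [h2, repPoint_snd]
    have := hw k
    have := hz k
    linarith
  have h1 : P.hcP (P.shift (P.repPoint y μ w - z).snd) ≤ ∑ i, P.f i (x i) :=
    iInf₂_le x ⟨hxY, hfeas⟩
  refine h1.trans ?_
  have h2 : ∑ i, (P.f i (x i)).toReal ≤ (P.repPoint y μ w).fst + ∑ i, r i := by
    rw [repPoint_fst, ← sum_add_distrib]
    refine sum_le_sum fun i _ => ?_
    have := hfx i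
    rwa [fY_eq hP (hxY i), EReal.coe_le_coe_iff] at this
  rw [hP.sum_f hxY]
  calc ((∑ i, (P.f i (x i)).toReal : ℝ) : EReal)
      ≤ ((z.fst + (|(P.repPoint y μ w - z).fst| + ∑ i, r i) : ℝ) : EReal) := by
        rw [EReal.coe_le_coe_iff]
        have := le_abs_self (P.repPoint y μ w - z).fst
        rw [WithLp.sub_fst] at this ⊢
        linarith
    _ ≤ _ := by
        rw [EReal.coe_add, EReal.coe_add]
        gcongr

end SepProblem

/-! ### Sparsifying convex weights by sampling -/

section Sparsification

open Finset

/-- Convex weights have at least one entry equal to `1` or at least two nonzero entries different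
from `1`. -/
theorem two_le_two_mul_card_add_card {ι : Type*} [Fintype ι] {w : ι → ℝ} (h : ∑ j, w j = 1) :
    2 ≤ 2 * #{j | w j = 1} + #{j | w j ≠ 0 ∧ w j ≠ 1} := by
  classical
  by_cases h1 : ∃ j, w j = 1
  · obtain ⟨j, hj⟩ := h1
    have : 0 < #{j | w j = 1} := card_pos.2 ⟨j, by simp [hj]⟩
    omega
  push Not at h1
  have h2 : ({j | w j ≠ 0 ∧ w j ≠ 1} : Finset ι) = ({j | w j ≠ 0} : Finset ι) := by
    ext j
    simp [h1 j]
  have h3 := SepProblem.one_le_card_of_sum_eq_one h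
  rw [h2]
  by_contra! h4
  obtain ⟨j₀, hj₀⟩ := card_eq_one.1 (show #{j | w j ≠ 0} = 1 by omega)
  refine h1 j₀ ?_
  rw [← h, sum_eq_single j₀ _ (by simp)]
  intro j _ hj
  by_contra h5
  have : j ∈ ({j | w j ≠ 0} : Finset ι) := by simpa using h5
  rw [hj₀, mem_singleton] at this
  exact hj this

theorem card_eq_one_add_card {ι : Type*} [Fintype ι] (w : ι → ℝ) :
    #{j | w j ≠ 0} = #{j | w j = 1} + #{j | w j ≠ 0 ∧ w j ≠ 1} := by
  classical
  rw [← card_union_of_disjoint]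
  · congr 1
    ext j
    by_cases h : w j = 1 <;> simp [h]
  · rw [disjoint_filter]
    exact fun j _ h h' => h'.2 h

theorem card_eq_one_le_one {ι : Type*} [Fintype ι] {w : ι → ℝ} (h0 : ∀ j, 0 ≤ w j)
    (h : ∑ j, w j = 1) : #{j | w j = 1} ≤ 1 := by
  have h1 : ∑ j ∈ ({j | w j = 1} : Finset ι), w j ≤ ∑ j, w j :=
    sum_le_univ_sum_of_nonneg h0
  rw [h, sum_congr rfl fun j hj => (mem_filter.1 hj).2, sum_const, nsmul_eq_mul, mul_one] at h1
  exact_mod_cast h1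

/-- The norm bound defines a convex set of tuples, and the product of the convex hulls of the rows
is the convex hull of the product. -/
theorem norm_sum_smul_le_of_convex {n : ℕ} {T E : Type*} [Fintype T] [NormedAddCommGroup E]
    [NormedSpace ℝ E] (z : Fin n → T → E) (δ : Fin n → ℝ) {C : ℝ}
    (hC : ∀ κ : Fin n → T, ‖∑ i, δ i • z i (κ i)‖ ≤ C) (μ : Fin n → T → ℝ)
    (hμ : ∀ i t, 0 ≤ μ i t) (hsum : ∀ i, ∑ t, μ i t = 1) :
    ‖∑ i, δ i • ∑ t, μ i t • z i t‖ ≤ C := by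
  let S : Set (Fin n → E) := {p | ‖∑ i, δ i • p i‖ ≤ C}
  have hS : Convex ℝ S := by
    let F : (Fin n → E) →ₗ[ℝ] E := ∑ i, δ i • LinearMap.proj i
    have : S = F ⁻¹' Metric.closedBall 0 C := by
      ext p
      simp [S, F]
    rw [this]
    exact (convex_closedBall 0 C).linear_preimage F
  have h1 : convexHull ℝ (Set.univ.pi fun i => Set.range (z i)) ⊆ S := by
    refine convexHull_min (fun p hp => ?_) hS
    choose κ hκ using fun i => hp i (Set.mem_univ i)
    simpa [S, hκ] using hC κ
  have h2 : (fun i => ∑ t, μ i t • z i t) ∈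
      convexHull ℝ (Set.univ.pi fun i => Set.range (z i)) := by
    rw [convexHull_pi]
    exact fun i _ => mem_convexHull_of_exists_fintype (μ i) (z i) (hμ i) (hsum i)
      (fun t => ⟨t, rfl⟩) rfl
  exact h1 h2

/-- An approximate Shapley-Folkman lemma: rows of convex weights, `N` of which are not trivial, can
be replaced by rows of convex weights with `n + k` nonzero entries in total. -/
theorem exists_sparse_weights {n : ℕ} {T E : Type} [Fintype T] [NormedAddCommGroup E]
    [InnerProductSpace ℝ E] (z : Fin n → T → E) (lam : Fin n → T → ℝ)
    (hlam : ∀ i t, 0 ≤ lam i t) (hsum : ∀ i, ∑ t, lam i t = 1) {M R Λ : ℝ} (hM : 0 ≤ M)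
    (hMz : ∀ (δ : EuclideanSpace ℝ (Fin n)) (κ : Fin n → T), ‖∑ i, δ i • z i (κ i)‖ ≤ M * ‖δ‖)
    (hR : ∀ i t, lam i t ≠ 1 → ‖lam i t • z i t‖ ≤ R)
    (hΛ : ∀ i t, lam i t ≠ 1 → lam i t ≤ Λ) {N k : ℕ}
    (hN : ∑ i, #{t | lam i t ≠ 0 ∧ lam i t ≠ 1} = N) (hN0 : 0 < N) (hk : 0 < k) :
    ∃ μ : Fin n → T → ℝ, (∀ i t, 0 ≤ μ i t) ∧ (∀ i, ∑ t, μ i t = 1) ∧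
      (∀ i t, lam i t = 0 → μ i t = 0) ∧ ∑ i, #{t | μ i t ≠ 0} ≤ n + k ∧
      ‖∑ i, ∑ t, μ i t • z i t - ∑ i, ∑ t, lam i t • z i t‖ ^ 2 ≤
        2 * (N : ℝ) ^ 2 * (R ^ 2 + M ^ 2 * Λ ^ 2) / k := by
  classical
  let ι := {q : Fin n × T // lam q.1 q.2 ≠ 0 ∧ lam q.1 q.2 ≠ 1}
  have hcard : Fintype.card ι = N := by
    rw [Fintype.card_subtype, ← hN]
    simp only [card_filter, Fintype.sum_prod_type]
  have : Nonempty ι := Fintype.card_pos_iff.1 (by omega)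
  -- The second component records the contribution to the row sum, scaled by `M`, the price of
  -- renormalising a row.
  let a : ι → WithLp 2 (E × EuclideanSpace ℝ (Fin n)) := fun q =>
    WithLp.toLp 2 (lam q.1.1 q.1.2 • z q.1.1 q.1.2,
      EuclideanSpace.single q.1.1 (M * lam q.1.1 q.1.2))
  have ha : ∀ q, ‖a q‖ ^ 2 ≤ R ^ 2 + M ^ 2 * Λ ^ 2 := by
    intro q
    rw [WithLp.prod_norm_sq_eq_of_L2]
    simp only [a, WithLp.toLp_fst, WithLp.toLp_snd, PiLp.norm_single]
    have h1 := hR _ _ q.2.2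
    have h2 := hΛ _ _ q.2.2
    have h3 := hlam q.1.1 q.1.2
    rw [Real.norm_eq_abs, sq_abs, mul_pow]
    gcongr
  obtain ⟨c, hc, hb⟩ := exists_sampling a _ ha k
  rw [hcard] at hb
  set X := ∑ q, ((N : ℝ) * c q - k) • a q with hX
  have hk' : (0 : ℝ) < k := by exact_mod_cast hk
  let c' : Fin n → T → ℕ := fun i t =>
    if h : lam i t ≠ 0 ∧ lam i t ≠ 1 then c ⟨(i, t), h⟩ else 0
  have hcq : ∀ q : ι, c' q.1.1 q.1.2 = c q := fun q => dif_pos q.2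
  have hc' : ∑ i, ∑ t, c' i t = k := by
    rw [← hc, ← Fintype.sum_prod_type']
    symm
    refine Fintype.sum_of_injective (fun q : ι => q.1) Subtype.val_injective _ _ ?_ ?_
    · intro q hq
      exact dif_neg fun h => hq ⟨⟨q, h⟩, rfl⟩
    · exact fun q => (hcq q).symm
  -- Sampled weights: the fractional ones are multiplied by `N / k` times the number of draws, the
  -- others are kept.
  let lam' : Fin n → T → ℝ := fun i t =>
    if lam i t ≠ 0 ∧ lam i t ≠ 1 then lam i t * (N * c' i t / k) else lam i t
  have hlam' : ∀ i t, 0 ≤ lam' i t := by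
    intro i t
    have := hlam i t
    simp only [lam']
    split_ifs <;> positivity
  have hzero : ∀ i t, lam i t = 0 → lam' i t = 0 := by
    intro i t h
    simp [lam', h]
  have hdiff : ∀ {V : Type} [AddCommGroup V] [Module ℝ V] (v : Fin n → T → V),
      ∑ i, ∑ t, (lam' i t - lam i t) • v i t
        = (k : ℝ)⁻¹ • ∑ q : ι, ((N : ℝ) * c q - k) • lam q.1.1 q.1.2 • v q.1.1 q.1.2 := by
    intro V _ _ v
    rw [← Fintype.sum_prod_type' (f := fun i t => (lam' i t - lam i t) • v i t), smul_sum]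
    symm
    refine Fintype.sum_of_injective (fun q : ι => q.1) Subtype.val_injective _ _ ?_ ?_
    · intro q hq
      have : ¬ (lam q.1 q.2 ≠ 0 ∧ lam q.1 q.2 ≠ 1) := fun h => hq ⟨⟨q, h⟩, rfl⟩
      simp only [lam', if_neg this, sub_self, zero_smul]
    · intro q
      simp only [lam', if_pos q.2, hcq, smul_smul]
      congr 1
      field_simp
  set e₁ := ∑ i, ∑ t, (lam' i t - lam i t) • z i t with he₁
  have he₁X : e₁ = (k : ℝ)⁻¹ • X.fst := by
    rw [he₁, hdiff, hX, WithLp.sum_fst]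
    rfl
  set σ : Fin n → ℝ := fun i => ∑ t, lam' i t with hσ
  set δ : EuclideanSpace ℝ (Fin n) := WithLp.toLp 2 fun i => σ i - 1 with hδ
  have hδX : M • δ = (k : ℝ)⁻¹ • X.snd := by
    have h1 : M • δ = ∑ i, ∑ t, (lam' i t - lam i t) • EuclideanSpace.single i M := by
      ext l
      simp only [hδ, hσ, PiLp.smul_apply, smul_eq_mul, WithLp.ofLp_sum, Finset.sum_apply,
        PiLp.single_apply, ← sum_smul, sum_sub_distrib, hsum]
      rw [sum_eq_single l (fun i _ hi => by simp [hi.symm]) (by simp)]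
      simp [mul_comm]
    rw [h1, hdiff (fun i _ => EuclideanSpace.single i M), hX, WithLp.sum_snd]
    congr 1
    refine sum_congr rfl fun q _ => ?_
    rw [WithLp.smul_snd]
    congr 1
    ext l
    simp only [a, WithLp.toLp_snd, PiLp.smul_apply, PiLp.single_apply, smul_eq_mul, mul_ite,
      mul_zero, mul_comm]
  have hsq : ‖e₁‖ ^ 2 + (M * ‖δ‖) ^ 2 ≤ (N : ℝ) ^ 2 * (R ^ 2 + M ^ 2 * Λ ^ 2) / k := by
    have h1 : M * ‖δ‖ = ‖M • δ‖ := by rw [norm_smul, Real.norm_of_nonneg hM]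
    rw [h1, hδX, he₁X, norm_smul, norm_smul, mul_pow, mul_pow, ← mul_add,
      ← WithLp.prod_norm_sq_eq_of_L2, norm_inv, Real.norm_of_nonneg hk'.le, le_div_iff₀ hk']
    calc ((k : ℝ)⁻¹) ^ 2 * ‖X‖ ^ 2 * k
        ≤ ((k : ℝ)⁻¹) ^ 2 * (k * N ^ 2 * (R ^ 2 + M ^ 2 * Λ ^ 2)) * k := by gcongr
      _ = _ := by field_simp
  have hex : ∀ i, ∃ t, lam i t ≠ 0 := by
    intro i
    by_contra! h
    have := hsum i
    simp [h] at this
  choose t₀ ht₀ using hex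
  -- Renormalised rows. A row with `σ i = 0` was never drawn and has no weight `1`; it receives a
  -- single point of the original support, which costs one nonzero weight.
  let μ : Fin n → T → ℝ := fun i t =>
    if σ i ≠ 0 then lam' i t / σ i else if t = t₀ i then 1 else 0
  have hσ0 : ∀ i, 0 ≤ σ i := fun i => sum_nonneg fun t _ => hlam' i t
  have hμ0 : ∀ i t, 0 ≤ μ i t := by
    intro i t
    have := hσ0 i
    have := hlam' i t
    simp only [μ]
    split_ifs <;> positivity
  have hμ1 : ∀ i, ∑ t, μ i t = 1 := by
    intro i
    by_cases h : σ i = 0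
    · simp [μ, h]
    · simp only [μ, if_pos h, ← sum_div]
      exact div_self h
  have hσμ : ∀ i t, σ i * μ i t = lam' i t := by
    intro i t
    by_cases h : σ i = 0
    · rw [h, zero_mul]
      exact ((sum_eq_zero_iff_of_nonneg fun t _ => hlam' i t).1 h t (mem_univ t)).symm
    · simp only [μ, if_pos h]
      field_simp
  refine ⟨μ, hμ0, hμ1, ?_, ?_, ?_⟩
  · intro i t h
    simp only [μ]
    split_ifs with h1 h2
    · rw [hzero i t h, zero_div]
    · exact absurd (h2 ▸ h) (ht₀ i)
    · rfl
  · have hrow : ∀ i, #{t | μ i t ≠ 0} ≤ 1 + ∑ t, c' i t := by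
      intro i
      by_cases h : σ i = 0
      · have : ({t | μ i t ≠ 0} : Finset T) = {t₀ i} := by
          ext t
          simp [μ, h]
        rw [this, card_singleton]
        omega
      · have h1 : ({t | μ i t ≠ 0} : Finset T) ⊆
            ({t | lam i t = 1} : Finset T) ∪ ({t | c' i t ≠ 0} : Finset T) := by
          intro t ht
          simp only [mem_filter, mem_univ, true_and, mem_union] at ht ⊢
          by_contra! hcon
          apply ht
          simp only [μ, if_pos h, lam', hcon.2]
          split_ifs with h3
          · simp
          · have h4 : lam i t = 0 := by
              by_contra h5
              exact h3 ⟨h5, hcon.1⟩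
            simp [h4]
        refine (card_le_card h1).trans ((card_union_le _ _).trans ?_)
        gcongr
        · exact card_eq_one_le_one (hlam i) (hsum i)
        · rw [card_filter]
          refine sum_le_sum fun t _ => ?_
          split_ifs with h3
          · omega
          · omega
    refine (sum_le_sum fun i _ => hrow i).trans ?_
    rw [sum_add_distrib, hc']
    simp
  -- Since `σ i * μ i t = lam' i t`, the error is the sampling error minus the combination of the
  -- new rows with coefficients `δ i = σ i - 1`, which has norm at most `M * ‖δ‖`.
  · have hsplit : ∑ i, ∑ t, μ i t • z i t - ∑ i, ∑ t, lam i t • z i t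
        = e₁ - ∑ i, δ i • ∑ t, μ i t • z i t := by
      have h : ∀ i, δ i • ∑ t, μ i t • z i t = ∑ t, lam' i t • z i t - ∑ t, μ i t • z i t := by
        intro i
        change (σ i - 1) • _ = _
        rw [sub_smul, one_smul, smul_sum]
        simp only [smul_smul, hσμ]
      rw [he₁, ← sum_sub_distrib, ← sum_sub_distrib]
      refine sum_congr rfl fun i _ => ?_
      rw [h]
      simp only [sub_smul, sum_sub_distrib]
      abel
    have h1 := norm_sum_smul_le_of_convex z δ (hMz δ) μ hμ0 hμ1
    rw [hsplit]
    have h2 := (norm_sub_le e₁ (∑ i, δ i • ∑ t, μ i t • z i t)).trans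
      (add_le_add_right h1 _)
    calc _ ≤ (‖e₁‖ + M * ‖δ‖) ^ 2 := by gcongr
      _ ≤ 2 * (‖e₁‖ ^ 2 + (M * ‖δ‖) ^ 2) := add_sq_le
      _ ≤ 2 * ((N : ℝ) ^ 2 * (R ^ 2 + M ^ 2 * Λ ^ 2) / k) := by gcongr
      _ = _ := by ring

end Sparsification

/-! ### Error bounds for sparse representations -/

theorem ENNReal.iSup_fintype_ne_top {n p : ℕ} (q : Fin n → Fin p → Prop)
    (F : Fin n → Fin p → ENNReal) (hF : ∀ i j, F i j ≠ ⊤) :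
    (⨆ (i : Fin n) (j : Fin p) (_ : q i j), F i j) ≠ ⊤ := by
  refine ne_top_of_le_ne_top (b := ∑ i, ∑ j, F i j) ?_ ?_
  · exact ENNReal.sum_ne_top.2 fun i _ => ENNReal.sum_ne_top.2 fun j _ => hF i j
  · refine iSup_le fun i => iSup₂_le fun j _ => ?_
    exact (Finset.single_le_sum (f := fun j => F i j) (fun _ _ => zero_le) (Finset.mem_univ j)).trans
      (Finset.single_le_sum (f := fun i => ∑ j, F i j) (fun _ _ => zero_le) (Finset.mem_univ i))

namespace SepProblem

open Finset

variable {n m : ℕ} {d : Fin n → ℕ} {P : SepProblem n m d}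

theorem norm_sum_le_MV_mul (hM : P.MV ≠ ⊤) {x : ∀ i, Vec (d i)} (hx : ∀ i, x i ∈ P.Y i)
    (δ : Vec n) : ‖∑ i, δ i • P.val i (x i)‖ ≤ P.MV.toReal * ‖δ‖ := by
  rcases eq_or_ne δ 0 with rfl | hδ
  · simp
  have hδ0 : 0 < ‖δ‖ := norm_pos_iff.2 hδ
  have h1 : ‖∑ i, (‖δ‖⁻¹ • δ) i • P.val i (x i)‖ₑ ≤ P.MV := by
    refine le_trans ?_ (le_iSup _ (‖δ‖⁻¹ • δ))
    refine le_iSup₂ (f := fun (x : ∀ i, Vec (d i)) (_ : ‖‖δ‖⁻¹ • δ‖ ≤ 1 ∧ ∀ i, x i ∈ P.Y i) =>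
      ‖∑ i, (‖δ‖⁻¹ • δ) i • P.val i (x i)‖ₑ) x ⟨?_, hx⟩
    rw [norm_smul, norm_inv, norm_norm, inv_mul_cancel₀ hδ0.ne']
  have h2 : ∑ i, (‖δ‖⁻¹ • δ) i • P.val i (x i) = ‖δ‖⁻¹ • ∑ i, δ i • P.val i (x i) := by
    rw [smul_sum]
    exact sum_congr rfl fun i _ => by rw [PiLp.smul_apply, smul_eq_mul, mul_smul]
  rw [h2] at h1
  have h3 := ENNReal.toReal_mono hM h1
  rw [toReal_enorm, norm_smul, norm_inv, norm_norm, inv_mul_le_iff₀ hδ0] at h3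
  linarith

/-- Every row uses at least one nonzero weight, which leaves `m + 1` to spare; this is the factor in
`shift`. It survives sparsification because supports do not grow. -/
theorem card_rows_le {μ lam : Fin n → Fin (m + 2) → ℝ} (hμ : ∀ i, ∑ j, μ i j = 1)
    (h : ∀ i j, lam i j = 0 → μ i j = 0) (hcard : totalCard lam ≤ n + m + 1) :
    #{i | 2 ≤ #{j | μ i j ≠ 0}} ≤ m + 1 := by
  rw [totalCard] at hcard
  simp only [ncard_ne_zero_eq] at hcard
  have h1 : ∑ i : Fin n, (1 + if 2 ≤ #{j | μ i j ≠ 0} then 1 else 0)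
      ≤ ∑ i, #{j | lam i j ≠ 0} := by
    refine sum_le_sum fun i _ => ?_
    have h2 : #{j | μ i j ≠ 0} ≤ #{j | lam i j ≠ 0} := by
      refine card_le_card fun j => ?_
      simp only [mem_filter, mem_univ, true_and]
      exact fun h3 h4 => h3 (h i j h4)
    have h3 := one_le_card_of_sum_eq_one (hμ i)
    split_ifs <;> omega
  rw [sum_add_distrib, ← card_filter] at h1
  simp only [sum_const, card_univ, Fintype.card_fin, smul_eq_mul, mul_one] at h1
  omega

/-- The sparsity level with constant `16` makes the sampling error at most `√(2 m) γ`, if it is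
smaller than the trivial one. -/
theorem sampling_bound {m N : ℕ} {γ Q : ℝ} (hQ : 0 ≤ Q) (hN : N ≤ 2 * m + 2)
    (hlt : 2 * m * (16 / (γ ^ 2 + 16)) < (m : ℝ)) :
    2 * (N : ℝ) ^ 2 * Q / ((⌊2 * m * (16 / (γ ^ 2 + 16))⌋₊ + 1 : ℕ) : ℝ) ≤ 2 * m * γ ^ 2 * Q := by
  have hm0 : 0 < m := by
    rcases Nat.eq_zero_or_pos m with rfl | h
    · simp at hlt
    · exact h
  have hm : (1 : ℝ) ≤ m := by exact_mod_cast hm0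
  have hpos : (0 : ℝ) < γ ^ 2 + 16 := by positivity
  set t := 2 * (m : ℝ) * (16 / (γ ^ 2 + 16)) with ht
  have hγ : 16 ≤ γ ^ 2 := by
    have h : t * (γ ^ 2 + 16) = 32 * m := by
      rw [ht]
      field_simp
      ring
    nlinarith
  have hk : t ≤ ((⌊t⌋₊ + 1 : ℕ) : ℝ) := by
    push_cast
    exact (Nat.lt_floor_add_one t).le
  have hN' : (N : ℝ) ≤ 4 * m := by
    have : (N : ℝ) ≤ 2 * m + 2 := by exact_mod_cast hN
    linarith
  -- As `t = 32 m / (γ² + 16)`, this says `γ² + 16 ≤ 2γ²`; the number `16` comes from `N ≤ 4 m`.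
  have ht' : 16 * m ≤ γ ^ 2 * t := by
    rw [ht, mul_div_assoc', mul_div_assoc', le_div_iff₀ hpos]
    nlinarith
  rw [div_le_iff₀ (by positivity)]
  calc 2 * (N : ℝ) ^ 2 * Q ≤ 2 * (4 * m) ^ 2 * Q := by gcongr
    _ = 2 * m * (16 * m) * Q := by ring
    _ ≤ 2 * m * (γ ^ 2 * t) * Q := by gcongr
    _ ≤ 2 * m * (γ ^ 2 * ((⌊t⌋₊ + 1 : ℕ) : ℝ)) * Q := by gcongr
    _ = _ := by ring

/-- Sparsification of a representation, with control of the error. -/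
theorem exists_sparse_rep {x : ∀ i, Fin (m + 2) → Vec (d i)}
    {lam : Fin n → Fin (m + 2) → ℝ} (w : Vec m) (hrep : P.IsRep x lam)
    (hcard : totalCard lam ≤ n + m + 1) {γ : ℝ} (hγ : 0 < γ) :
    ∃ μ : Fin n → Fin (m + 2) → ℝ, P.IsRep x μ ∧ (totalCard μ : ℝ) ≤ sparsity n m 16 γ ∧
      (∀ i j, lam i j = 0 → μ i j = 0) ∧
      ‖P.repPoint x μ w - P.repPoint x lam w‖ₑ ≤ ENNReal.ofReal (Real.sqrt (2 * m)) *
        (P.Rv x lam + weightRadius lam * P.MV) * ENNReal.ofReal γ := by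
  -- If the given weights are already sparse enough, they are kept with zero error. Otherwise `2 m c
  -- / (γ² + c) < m`.
  by_cases hs : (totalCard lam : ℝ) ≤ sparsity n m 16 γ
  · exact ⟨lam, hrep, hs, fun _ _ => id, by simp⟩
  push Not at hs
  obtain ⟨hY, hlam, hsum⟩ := hrep
  have hcard' : (totalCard lam : ℝ) ≤ n + m + 1 := by exact_mod_cast hcard
  have htpos : 0 ≤ 2 * (m : ℝ) * (16 / (γ ^ 2 + 16)) := by positivity
  have hlt : 2 * m * (16 / (γ ^ 2 + 16)) < (m : ℝ) := by
    rw [sparsity] at hs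
    linarith
  have hgt : n + 1 < totalCard lam := by
    rw [sparsity] at hs
    have : (n : ℝ) + 1 < totalCard lam := by linarith
    exact_mod_cast this
  have hmne : m ≠ 0 := by
    rintro rfl
    simp at hlt
  set k := ⌊2 * (m : ℝ) * (16 / (γ ^ 2 + 16))⌋₊ + 1 with hk
  set N := ∑ i, #{j | lam i j ≠ 0 ∧ lam i j ≠ 1} with hN
  set A := ∑ i, #{j | lam i j = 1} with hA
  have htot : totalCard lam = A + N := by
    rw [totalCard, hA, hN, ← sum_add_distrib]
    exact sum_congr rfl fun i _ => by rw [ncard_ne_zero_eq, card_eq_one_add_card]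
  have hA' : A ≤ n := by
    calc A ≤ ∑ _i : Fin n, 1 := sum_le_sum fun i _ => card_eq_one_le_one (hlam i) (hsum i)
      _ = n := by simp
  have hrows : 2 * n ≤ 2 * A + N := by
    calc 2 * n = ∑ _i : Fin n, 2 := by simp [mul_comm]
      _ ≤ ∑ i, (2 * #{j | lam i j = 1} + #{j | lam i j ≠ 0 ∧ lam i j ≠ 1}) :=
        sum_le_sum fun i _ => two_le_two_mul_card_add_card (hsum i)
      _ = _ := by rw [sum_add_distrib, ← mul_sum]
  have hN0 : 0 < N := by omega
  -- From `A + N ≤ n + m + 1` and `2 n ≤ 2 A + N`.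
  have hN2 : N ≤ 2 * m + 2 := by omega
  have hsparse : ∀ μ : Fin n → Fin (m + 2) → ℝ, ∑ i, #{j | μ i j ≠ 0} ≤ n + k →
      (totalCard μ : ℝ) ≤ sparsity n m 16 γ := by
    intro μ hμ
    have h1 : (totalCard μ : ℝ) ≤ n + k := by
      rw [totalCard]
      simp only [ncard_ne_zero_eq]
      exact_mod_cast hμ
    have h2 := Nat.floor_le htpos
    rw [sparsity]
    rw [hk] at h1
    push_cast at h1
    linarith
  have hΛtop : weightRadius lam ≠ ⊤ :=
    ENNReal.iSup_fintype_ne_top _ _ fun _ _ => enorm_ne_top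
  have hRtop : P.Rv x lam ≠ ⊤ := ENNReal.iSup_fintype_ne_top _ _ fun _ _ => enorm_ne_top
  have hΛ' : ∀ i j, lam i j ≠ 1 → ‖lam i j‖ₑ ≤ weightRadius lam := fun i j h =>
    le_trans (le_iSup₂ (f := fun j (_ : lam i j ≠ 1) => ‖lam i j‖ₑ) j h)
      (le_iSup (fun i => ⨆ (j) (_ : lam i j ≠ 1), ‖lam i j‖ₑ) i)
  have hΛ : ∀ i j, lam i j ≠ 1 → lam i j ≤ (weightRadius lam).toReal := by
    intro i j h
    have := ENNReal.toReal_mono hΛtop (hΛ' i j h)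
    rwa [toReal_enorm, Real.norm_of_nonneg (hlam i j)] at this
  have hR : ∀ i j, lam i j ≠ 1 → ‖lam i j • P.val i (x i j)‖ ≤ (P.Rv x lam).toReal := by
    intro i j h
    have h1 : ‖lam i j • P.val i (x i j)‖ₑ ≤ P.Rv x lam :=
      le_trans (le_iSup₂ (f := fun j (_ : lam i j ≠ 1) => ‖lam i j • P.val i (x i j)‖ₑ) j h)
        (le_iSup (fun i => ⨆ (j) (_ : lam i j ≠ 1), ‖lam i j • P.val i (x i j)‖ₑ) i)
    have := ENNReal.toReal_mono hRtop h1
    rwa [toReal_enorm] at this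
  by_cases hM : P.MV = ⊤
  -- The right-hand side is infinite because `m`, `γ` and the weight radius are positive, so only
  -- the sparsity count matters and sampling is applied to zero vectors.
  · obtain ⟨μ, h1, h2, h3, h4, -⟩ := exists_sparse_weights
      (fun (_ : Fin n) (_ : Fin (m + 2)) => (0 : ℝ)) lam hlam hsum (M := 0) (R := 0) le_rfl
      (by simp) (by simp) hΛ rfl hN0 (Nat.succ_pos _ : 0 < k)
    refine ⟨μ, ⟨hY, h1, h2⟩, hsparse μ h4, h3, ?_⟩
    obtain ⟨i, -, hi⟩ := exists_ne_zero_of_sum_ne_zero hN0.ne'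
    obtain ⟨j, hj⟩ := card_ne_zero.1 hi
    simp only [mem_filter, mem_univ, true_and] at hj
    have h5 : weightRadius lam ≠ 0 := by
      intro h
      have := hΛ' i j hj.2
      rw [h, nonpos_iff_eq_zero, enorm_eq_zero] at this
      exact hj.1 this
    have h6 : ENNReal.ofReal (Real.sqrt (2 * m)) ≠ 0 := by
      rw [Ne, ENNReal.ofReal_eq_zero, not_le, Real.sqrt_pos]
      positivity
    have h7 : ENNReal.ofReal γ ≠ 0 := by
      rwa [Ne, ENNReal.ofReal_eq_zero, not_le]
    rw [hM, ENNReal.mul_top h5, add_top, ENNReal.mul_top h6, ENNReal.top_mul h7]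
    exact le_top
  · obtain ⟨μ, h1, h2, h3, h4, h5⟩ := exists_sparse_weights
      (fun i j => P.val i (x i j)) lam hlam hsum (M := P.MV.toReal) ENNReal.toReal_nonneg
      (fun δ κ => norm_sum_le_MV_mul hM (fun i => hY i (κ i)) δ) hR hΛ rfl hN0
      (Nat.succ_pos _ : 0 < k)
    refine ⟨μ, ⟨hY, h1, h2⟩, hsparse μ h4, h3, ?_⟩
    set R := (P.Rv x lam).toReal with hRdef
    set Λ := (weightRadius lam).toReal with hΛdef
    set M := P.MV.toReal with hMdef
    have hR0 : 0 ≤ R := ENNReal.toReal_nonneg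
    have hΛ0 : 0 ≤ Λ := ENNReal.toReal_nonneg
    have hM0 : 0 ≤ M := ENNReal.toReal_nonneg
    have h6 := h5.trans (sampling_bound (by positivity) hN2 hlt)
    have h7 : P.repPoint x μ w - P.repPoint x lam w =
        ∑ i, ∑ j, μ i j • P.val i (x i j) - ∑ i, ∑ j, lam i j • P.val i (x i j) := by
      rw [repPoint, repPoint]
      abel
    have h8 : ‖P.repPoint x μ w - P.repPoint x lam w‖ ≤
        Real.sqrt (2 * m) * (R + Λ * M) * γ := by
      rw [h7]
      refine (sq_le_sq₀ (norm_nonneg _) (by positivity)).1 (h6.trans ?_)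
      rw [mul_pow, mul_pow, Real.sq_sqrt (by positivity)]
      have h9 : R ^ 2 + M ^ 2 * Λ ^ 2 ≤ (R + Λ * M) ^ 2 := by
        nlinarith [mul_nonneg hR0 (mul_nonneg hΛ0 hM0)]
      calc 2 * (m : ℝ) * γ ^ 2 * (R ^ 2 + M ^ 2 * Λ ^ 2)
          ≤ 2 * (m : ℝ) * γ ^ 2 * (R + Λ * M) ^ 2 := by gcongr
        _ = _ := by ring
    rw [← ofReal_norm]
    refine (ENNReal.ofReal_le_ofReal h8).trans (le_of_eq ?_)
    rw [ENNReal.ofReal_mul (by positivity), ENNReal.ofReal_mul (by positivity),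
      ENNReal.ofReal_add hR0 (by positivity), ENNReal.ofReal_mul hΛ0,
      ENNReal.ofReal_toReal hRtop, ENNReal.ofReal_toReal hΛtop, ENNReal.ofReal_toReal hM]

end SepProblem

/-! ### The main theorem -/

theorem mainTheorem9 :
    ∃ c : ℝ, 0 < c ∧
      ∀ (n m : ℕ) (d : Fin n → ℕ) (P : SepProblem n m d),
        (∀ i, LowerSemicontinuous (P.f i)) →
        (∀ i k, LowerSemicontinuous fun x => P.g i x k) →
        (∀ i, IsCompact (P.Y i)) →
        (∀ i, P.Y i ⊆ effDom (P.f i)) →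
        (∀ i, IsTame fun x => P.fY i x + ((∑ k, P.g i x k : ℝ) : EReal)) →
        P.rhoBarG ≠ ⊤ →
        P.hcD 0 ≠ ⊤ →
        P.hcD 0 = P.dualValue ∧
        (∃ (x : ∀ i, Fin (m + 2) → Vec (d i)) (lam : Fin n → Fin (m + 2) → ℝ) (w : Vec m),
          P.IsRep x lam ∧ totalCard lam ≤ n + m + 1 ∧ (∀ k, 0 ≤ w k) ∧
          P.AttainsDual (P.repPoint x lam w)) ∧
        ∀ (x : ∀ i, Fin (m + 2) → Vec (d i)) (lam : Fin n → Fin (m + 2) → ℝ) (w : Vec m),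
          P.IsRep x lam → totalCard lam ≤ n + m + 1 → (∀ k, 0 ≤ w k) →
          P.AttainsDual (P.repPoint x lam w) →
          ∀ γ : ℝ, 0 < γ →
            ∃ (u : ValSpace m) (y : ∀ i, Fin (m + 2) → Vec (d i)) (μ : Fin n → Fin (m + 2) → ℝ),
              P.IsRep y μ ∧ (totalCard μ : ℝ) ≤ sparsity n m c γ ∧
              u = P.repPoint y μ w - P.repPoint x lam w ∧
              P.hcD (P.shift u.snd) ≤ P.hcP (P.shift u.snd) ∧
              P.hcP (P.shift u.snd) ≤
                P.hcD 0 + (((|u.fst| : ℝ) : EReal) + P.maxRho (sparsity n m c γ)) ∧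
              max ‖u.fst‖ₑ ‖u.snd‖ₑ ≤
                ENNReal.ofReal (Real.sqrt (2 * m)) *
                  (P.Rv x lam + weightRadius lam * P.MV) * ENNReal.ofReal γ := by
  refine ⟨16, by norm_num, fun n m d P hf hg hY hdom htame hρ htop => ?_⟩
  have hP := SepProblem.isRegular_of_isTame hf hg hY hdom htame
  have hD := hP.hcD_zero
  refine ⟨hD, SepProblem.exists_attainsDual hP (hD ▸ htop), ?_⟩
  intro x lam w hrep hcard hw hatt γ hγ
  obtain ⟨μ, h1, h2, h3, h4⟩ := SepProblem.exists_sparse_rep w hrep hcard hγ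
  refine ⟨_, x, μ, h1, h2, rfl, biconj_le _ _, ?_, ?_⟩
  · rw [hD, ← hatt.value]
    exact SepProblem.hcP_shift_le hP hρ h1 hw
      (SepProblem.card_rows_le h1.2.2 h3 hcard) h2 hatt.nonpos
  · exact (max_le (WithLp.enorm_fst_le _ _) (WithLp.enorm_snd_le _ _)).trans h4
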